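/- **Setting.** Let $M=\{x\in\mathbb R^3:|x|>\rho_0\}$, $\rho_0\ge 0$, and let $(M,g,k)$ be a smooth spherically symmetric initial data set: $g$ is a Riemannian metric and $k$ a symmetric 2-tensor on $M$, both invariant under the action of $SO(3)$. Put $\mu=\tfrac12(R+(\operatorname{tr}_gk)^2-|k|^2)$ and $J=\operatorname{div}(k-(\operatorname{tr}_gk)g)$. Let $S_r=\{|x|=r\}$, with outward $g$-unit normal $\nu$, mean curvature $H=\operatorname{div}\nu$, null expansions $\theta_\pm=H\pm(\operatorname{tr}_gk-k(\nu,\nu))$, area $|S_r|$, and spacetime Hawking energy $$\mathfrak m_H(S_r)=\sqrt{\tfrac{|S_r|}{16\pi}}\Big(1-\tfrac1{16\pi}\int_{S_r}\theta_+\theta_-\,dA\Big).$$ Let $\Sigma_0=S_{r_0}\subset M$ be an outermost apparent horizon: $\theta_+=0$ on $\Sigma_0$ or $\theta_-=0$ on $\Sigma_0$, and neither $\theta_+$ nor $\theta_-$ vanishes on $S_r$ for any $r>r_0$. Assume the dominant energy condition $\mu\ge|J|$ for $|x|\ge r_0$. Assume that $(M,g,k)$ is asymptotically flat or, more generally, that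 $\theta_+,\theta_->0$ on $S_r$ for some $r>r_0$. Here asymptotically flat means that $g-\delta=O_2(|x|^{-q})$ and $k=O_1(|x|^{-q-1})$ for some $q>\frac12$. For functions $u,v$ put $\nu_u=\nabla u/|\nabla u|$, $\nu_v=\nabla v/|\nabla v|$, $$\overline\nabla^2_{+}u=\nabla^2u+k|\nabla u|-\tfrac{|\nabla u||\nabla v|+\langle\nabla u,\nabla v\rangle}{u+v}g+\tfrac{\nabla u\otimes\nabla v+\nabla v\otimes\nabla u}{u+v},$$ $$\overline\nabla^2_{-}v=\nabla^2v-k|\nabla v|-\tfrac{|\nabla u||\nabla v|+\langle\nabla u,\nabla v\rangle}{u+v}g+\tfrac{\nabla u\otimes\nabla v+\nabla v\otimes\nabla u}{u+v},$$ $$Y=2\nabla(|\nabla u|+|\nabla v|)+2k(\nabla(u-v),\cdot)+4\tfrac{|\nabla u|\nabla v+|\nabla v|\nabla u}{u+v}-2\Delta u\,\nu_u-2\Delta v\,\nu_v-2(\operatorname{tr}_gk)\nabla(u-v).$$ **Theorem.** (1) There are positive functions $u,v$ on $\{|x|\ge r_0\}$, smooth up to $\Sigma_0$ and depending only on $|x|$,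 which for $|x|>r_0$ satisfy $\nabla u,\nabla v\ne0$ and solve the system with $a=1$: $$\operatorname{tr}_g\overline\nabla^2_+u=(\overline\nabla^2_+u)(\nu_u,\nu_u),\qquad \operatorname{tr}_g\overline\nabla^2_-v=(\overline\nabla^2_-v)(\nu_v,\nu_v).$$ Moreover, $s=u+v$ satisfies $\nabla s\neq0$ and the rescaled inverse mean curvature flow equation $\Delta s=\nabla^2s(\nu_s,\nu_s)+2|\nabla s|^2/s$ with $\nu_s=\nabla s/|\nabla s|$ for $|x|>r_0$, and $s=\sqrt{|S_r|/16\pi}$ on $S_r$ for every $r\ge r_0$, in particular $s=\sqrt{|\Sigma_0|/16\pi}$ on $\Sigma_0$. The function $w=v-u$ is $$w=\int\tfrac12(\operatorname{tr}_gk-k(\nu,\nu))\,s\,d\rho,$$ the integral with respect to $g$-arclength along the radial path from $\Sigma_0$. Finally $|\nabla v|=\tfrac14\theta_+s$ and $|\nabla u|=\tfrac14\theta_-s$ for $|x|>r_0$. (2) For these $u,v$ the divergence identity $$\operatorname{div}Y=\tfrac{|\overline\nabla^2_+u|^2-((\overline\nabla^2_+u)(\nu_u,\nu_u))^2}{|\nabla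 u|}+\tfrac{|\overline\nabla^2_-v|^2-((\overline\nabla^2_-v)(\nu_v,\nu_v))^2}{|\nabla v|}+2\mu(|\nabla u|+|\nabla v|)+2\langle J,\nabla u-\nabla v\rangle-2K_u|\nabla u|-2K_v|\nabla v|$$ holds for $|x|>r_0$, where $K_u,K_v$ are the Gaussian curvatures of the level sets of $u,v$. The sum of its first two terms is zero, $\mu(|\nabla u|+|\nabla v|)+\langle J,\nabla u-\nabla v\rangle\ge0$, and $\langle Y,\nu\rangle=-\tfrac12 s\,\theta_+\theta_-$. For $r_0\le r_1\le r_2$ the following integrals over $\Omega=\{r_1<|x|<r_2\}$ converge absolutely and $$\int_{\Omega}\operatorname{div}Y\,dV=-\tfrac12\sqrt{\tfrac{|S_{r_2}|}{16\pi}}\int_{S_{r_2}}\theta_+\theta_-\,dA+\tfrac12\sqrt{\tfrac{|S_{r_1}|}{16\pi}}\int_{S_{r_1}}\theta_+\theta_-\,dA,$$ $$\int_{\Omega}(K_u|\nabla u|+K_v|\nabla v|)\,dV=4\pi\Big(\sqrt{\tfrac{|S_{r_2}|}{16\pi}}-\sqrt{\tfrac{|S_{r_1}|}{16\pi}}\Big),$$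 so that the identity reduces to the monotonicity formula $$\mathfrak m_H(S_{r_2})-\mathfrak m_H(S_{r_1})=\frac1{4\pi}\int_{\Omega}\big(\mu(|\nabla u|+|\nabla v|)+\langle J,\nabla u-\nabla v\rangle\big)\,dV.$$ (3) $\mathfrak m_H(S_{r_1})\le\mathfrak m_H(S_{r_2})$ whenever $r_0\le r_1\le r_2$. (4) (Penrose inequality) If $(M,g,k)$ is asymptotically flat with ADM energy $$E=\lim_{r\to\infty}\tfrac1{16\pi}\int_{S_r}\sum_{i,j}(\partial_ig_{ij}-\partial_jg_{ii})\tfrac{x^j}{|x|}\,dA_\delta$$ and ADM momentum $$P_i=\lim_{r\to\infty}\tfrac1{8\pi}\int_{S_r}\sum_j(k_{ij}-(\operatorname{tr}_gk)g_{ij})\tfrac{x^j}{|x|}\,dA_\delta$$ (the limits being assumed to exist; $dA_\delta$ is the Euclidean area element), then $|P|\le E$ and $$\sqrt{E^2-|P|^2}\ \ge\ \sqrt{\tfrac{|\Sigma_0|}{16\pi}}.$$ -/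

import Mathlib

open Filter Topology MeasureTheory
open scoped ContDiff

noncomputable section

namespace SphIDS

/-! Tensor calculus in a coordinate domain of `ℝⁿ`. A tensor field is given by its components;
a Riemannian metric is a field of symmetric positive definite matrices `g`. -/

/-- Points of the coordinate domain. -/
abbrev Pt (n : ℕ) : Type := EuclideanSpace ℝ (Fin n)

/-- Fields of `n × n` matrices, i.e. covariant 2-tensor fields in components. -/
abbrev Tensor2 (n : ℕ) : Type := Pt n → Matrix (Fin n) (Fin n) ℝ

variable {n : ℕ}

/-- The partial derivative `∂ᵢ f`. -/
def pd (i : Fin n) (f : Pt n → ℝ) (x : Pt n) : ℝ :=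
  fderiv ℝ f x (EuclideanSpace.single i 1)

/-- The components `gⁱʲ` of the inverse metric. -/
def ginv (g : Tensor2 n) (x : Pt n) (i j : Fin n) : ℝ := (g x)⁻¹ i j

/-- The Christoffel symbol `Γᵐᵢⱼ` of the Levi-Civita connection. -/
def christoffel (g : Tensor2 n) (m i j : Fin n) (x : Pt n) : ℝ :=
  (1 / 2) * ∑ l, ginv g x m l *
    (pd i (fun y => g y j l) x + pd j (fun y => g y i l) x - pd l (fun y => g y i j) x)

/-- The Ricci tensor
`Rᵢⱼ = ∂ₘΓᵐᵢⱼ - ∂ⱼΓᵐᵢₘ + Γᵐₘₗ Γˡᵢⱼ - Γᵐⱼₗ Γˡᵢₘ`. -/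
def ricci (g : Tensor2 n) (i j : Fin n) (x : Pt n) : ℝ :=
  (∑ m, (pd m (christoffel g m i j) x - pd j (christoffel g m i m) x)) +
    ∑ m, ∑ l, (christoffel g m m l x * christoffel g l i j x -
      christoffel g m j l x * christoffel g l i m x)

/-- The trace `gⁱʲ Tᵢⱼ`. -/
def tr (g T : Tensor2 n) (x : Pt n) : ℝ := ∑ i, ∑ j, ginv g x i j * T x i j

/-- The scalar curvature. -/
def scalarCurv (g : Tensor2 n) (x : Pt n) : ℝ := tr g (fun y => Matrix.of fun i j => ricci g i j y) x

/-- The squared norm `gⁱᵃ gʲᵇ Tᵢⱼ Tₐᵦ` of a 2-tensor. -/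
def normSq2 (g T : Tensor2 n) (x : Pt n) : ℝ :=
  ∑ i, ∑ j, ∑ a, ∑ b, ginv g x i a * ginv g x j b * T x i j * T x a b

/-- The gradient `(∇f)ⁱ = gⁱʲ ∂ⱼ f`. -/
def grad (g : Tensor2 n) (f : Pt n → ℝ) (x : Pt n) (i : Fin n) : ℝ :=
  ∑ j, ginv g x i j * pd j f x

/-- The inner product `⟨∇f, ∇h⟩`. -/
def gradInner (g : Tensor2 n) (f h : Pt n → ℝ) (x : Pt n) : ℝ :=
  ∑ i, ∑ j, ginv g x i j * pd i f x * pd j h x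

/-- The length `|∇f|`. -/
def gradNorm (g : Tensor2 n) (f : Pt n → ℝ) (x : Pt n) : ℝ := Real.sqrt (gradInner g f f x)

/-- The Hessian `∇ᵢⱼ f = ∂ᵢ∂ⱼ f - Γᵐᵢⱼ ∂ₘ f`. -/
def hess (g : Tensor2 n) (f : Pt n → ℝ) : Tensor2 n := fun x => Matrix.of fun i j =>
  pd i (pd j f) x - ∑ m, christoffel g m i j x * pd m f x

/-- The Laplacian, as the trace of the Hessian. -/
def laplacian (g : Tensor2 n) (f : Pt n → ℝ) : Pt n → ℝ := tr g (hess g f)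

/-- The divergence `∇ᵢ Xⁱ = ∂ᵢ Xⁱ + Γⁱᵢⱼ Xʲ` of a vector field. -/
def diverg (g : Tensor2 n) (X : Pt n → Fin n → ℝ) (x : Pt n) : ℝ :=
  ∑ i, (pd i (fun y => X y i) x + ∑ j, christoffel g i i j x * X x j)

/-- The covariant derivative `∇ᵢ Tⱼₘ` of a covariant 2-tensor. -/
def covDeriv2 (g T : Tensor2 n) (i j m : Fin n) (x : Pt n) : ℝ :=
  pd i (fun y => T y j m) x
    - ∑ l, (christoffel g l i j x * T x l m + christoffel g l i m x * T x j l)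

/-- The divergence `(div T)ₘ = gⁱʲ ∇ᵢ Tⱼₘ` of a covariant 2-tensor. -/
def diverg2 (g T : Tensor2 n) (x : Pt n) (m : Fin n) : ℝ :=
  ∑ i, ∑ j, ginv g x i j * covDeriv2 g T i j m x

/-- The bilinear form `T(X, Z)`. -/
def ev (T : Tensor2 n) (x : Pt n) (X Z : Fin n → ℝ) : ℝ := ∑ i, ∑ j, T x i j * X i * Z j

/-- The unit normal `∇f / |∇f|` to the level sets of `f`. -/
def unitNormal (g : Tensor2 n) (f : Pt n → ℝ) (x : Pt n) (i : Fin n) : ℝ :=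
  grad g f x i / gradNorm g f x

/-- The component `T(ν, ν)`, where `ν = ∇f / |∇f|`. -/
def normalPart (g : Tensor2 n) (f : Pt n → ℝ) (T : Tensor2 n) (x : Pt n) : ℝ :=
  ev T x (unitNormal g f x) (unitNormal g f x)

/-- The trace `tr_Σ T = tr_g T - T(ν, ν)` of `T` over the tangent spaces of the level sets of `f`. -/
def tangTrace (g : Tensor2 n) (f : Pt n → ℝ) (T : Tensor2 n) (x : Pt n) : ℝ :=
  tr g T x - normalPart g f T x

/-- The mean curvature `H = div ν` of the level sets of `f` with respect to `ν = ∇f / |∇f|`. -/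
def meanCurv (g : Tensor2 n) (f : Pt n → ℝ) (x : Pt n) : ℝ := diverg g (unitNormal g f) x

/-- The pullback `φ^* g` of a metric under a map `φ`. -/
def pullback {m n : ℕ} (g : Tensor2 n) (φ : Pt m → Pt n) : Tensor2 m := fun y =>
  Matrix.of fun a b => ∑ i, ∑ j,
    g (φ y) i j * pd a (fun z => φ z i) y * pd b (fun z => φ z j) y

/-- `κ` is the Gaussian curvature at `x` of the level set of `f` through `x`: half the scalar
curvature of the induced metric, computed in a regular local parametrization `φ` of the level
set with `φ 0 = x`. -/
def HasGaussCurvAt (g : Tensor2 3) (f : Pt 3 → ℝ) (x : Pt 3) (κ : ℝ) : Prop :=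
  ∃ (φ : Pt 2 → Pt 3) (U : Set (Pt 2)), IsOpen U ∧ (0 : Pt 2) ∈ U ∧ ContDiffOn ℝ ∞ φ U ∧
    (∀ y ∈ U, Function.Injective (fderiv ℝ φ y)) ∧ φ 0 = x ∧ (∀ y ∈ U, f (φ y) = f x) ∧
    κ = (1 / 2) * scalarCurv (pullback g φ) 0

/-- Spherical coordinates `(θ, ϕ)` on the coordinate sphere of radius `r`. -/
def sphereParam (r : ℝ) (y : Pt 2) : Pt 3 :=
  !₂[r * (Real.sin (y 0) * Real.cos (y 1)), r * (Real.sin (y 0) * Real.sin (y 1)),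
    r * Real.cos (y 0)]

/-- The surface integral `∫_{|x| = r} F dA` with respect to the area element induced by `g`. -/
def sphereIntegral (g : Tensor2 3) (r : ℝ) (F : Pt 3 → ℝ) : ℝ :=
  ∫ θ in (0 : ℝ)..Real.pi, ∫ ϕ in (0 : ℝ)..(2 * Real.pi),
    F (sphereParam r !₂[θ, ϕ]) * Real.sqrt (pullback g (sphereParam r) !₂[θ, ϕ]).det

/-- The open shell `r₁ < |x| < r₂`. -/
def shell (r₁ r₂ : ℝ) : Set (Pt 3) := {x | r₁ < ‖x‖ ∧ ‖x‖ < r₂}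

/-- The density of the Riemannian volume element `dV` with respect to Lebesgue measure. -/
def volDensity (g : Tensor2 n) (x : Pt n) : ℝ := Real.sqrt (g x).det

/-- The volume integral `∫ F dV` over the shell `r₁ < |x| < r₂`. -/
def shellIntegral (g : Tensor2 3) (r₁ r₂ : ℝ) (F : Pt 3 → ℝ) : ℝ :=
  ∫ x in shell r₁ r₂, F x * volDensity g x

/-! The system of partial differential equations. -/

/-- `∇̄²₊ u = ∇²u + k|∇u| - (|∇u||∇v| + ⟨∇u,∇v⟩)/(u+v) g + (∇u⊗∇v + ∇v⊗∇u)/(u+v)`. -/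
def barHessPlus (g k : Tensor2 n) (u v : Pt n → ℝ) : Tensor2 n := fun x => Matrix.of fun i j =>
  hess g u x i j + k x i j * gradNorm g u x
    - (gradNorm g u x * gradNorm g v x + gradInner g u v x) / (u x + v x) * g x i j
    + (pd i u x * pd j v x + pd j u x * pd i v x) / (u x + v x)

/-- `∇̄²₋ v = ∇²v - k|∇v| - (|∇u||∇v| + ⟨∇u,∇v⟩)/(u+v) g + (∇u⊗∇v + ∇v⊗∇u)/(u+v)`. -/
def barHessMinus (g k : Tensor2 n) (u v : Pt n → ℝ) : Tensor2 n := fun x => Matrix.of fun i j =>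
  hess g v x i j - k x i j * gradNorm g v x
    - (gradNorm g u x * gradNorm g v x + gradInner g u v x) / (u x + v x) * g x i j
    + (pd i u x * pd j v x + pd j u x * pd i v x) / (u x + v x)

/-- The system with parameter `a` at the point `x`:
`tr ∇̄²₊u = a (∇̄²₊u)(ν_u, ν_u)` and `tr ∇̄²₋v = a (∇̄²₋v)(ν_v, ν_v)`. -/
def SystemAt (a : ℝ) (g k : Tensor2 n) (u v : Pt n → ℝ) (x : Pt n) : Prop :=
  tr g (barHessPlus g k u v) x = a * normalPart g u (barHessPlus g k u v) x ∧
  tr g (barHessMinus g k u v) x = a * normalPart g v (barHessMinus g k u v) x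

/-- The rescaled inverse mean curvature flow equation `Δs = ∇²s(ν,ν) + 2|∇s|²/s`, `ν = ∇s/|∇s|`. -/
def RescaledIMCFAt (g : Tensor2 n) (s : Pt n → ℝ) (x : Pt n) : Prop :=
  laplacian g s x = normalPart g s (hess g s) x + 2 * gradNorm g s x ^ 2 / s x

/-- The vector field `Y` of the divergence identity. -/
def fieldY (g k : Tensor2 n) (u v : Pt n → ℝ) (x : Pt n) (i : Fin n) : ℝ :=
  2 * grad g (fun y => gradNorm g u y + gradNorm g v y) x i
    + 2 * (∑ j, ∑ l, ginv g x i j * k x j l * (grad g u x l - grad g v x l))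
    + 4 * (gradNorm g u x * grad g v x i + gradNorm g v x * grad g u x i) / (u x + v x)
    - 2 * laplacian g u x * grad g u x i / gradNorm g u x
    - 2 * laplacian g v x * grad g v x i / gradNorm g v x
    - 2 * tr g k x * (grad g u x i - grad g v x i)

/-- The energy density `μ = (R + (tr k)² - |k|²) / 2`. -/
def energyDensity (g k : Tensor2 n) (x : Pt n) : ℝ :=
  (1 / 2) * (scalarCurv g x + tr g k x ^ 2 - normSq2 g k x)

/-- The momentum density `J = div (k - (tr k) g)`, a covector. -/
def momentumDensity (g k : Tensor2 n) (x : Pt n) (m : Fin n) : ℝ :=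
  diverg2 g (fun y => k y - tr g k y • g y) x m

/-- The length `|J|` of the momentum density. -/
def momentumNorm (g k : Tensor2 n) (x : Pt n) : ℝ :=
  Real.sqrt (∑ i, ∑ j, ginv g x i j * momentumDensity g k x i * momentumDensity g k x j)

/-- The matter term `μ(|∇u| + |∇v|) + ⟨J, ∇u - ∇v⟩`. -/
def matterTerm (g k : Tensor2 n) (u v : Pt n → ℝ) (x : Pt n) : ℝ :=
  energyDensity g k x * (gradNorm g u x + gradNorm g v x)
    + ∑ i, momentumDensity g k x i * (grad g u x i - grad g v x i)

/-- The Hessian terms of the divergence identity: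
`(|∇̄²₊u|² - (a ∇̄²₊u(ν_u,ν_u))²)/|∇u| + (|∇̄²₋v|² - (a ∇̄²₋v(ν_v,ν_v))²)/|∇v|`. -/
def hessianTerm (a : ℝ) (g k : Tensor2 n) (u v : Pt n → ℝ) (x : Pt n) : ℝ :=
  (normSq2 g (barHessPlus g k u v) x
      - (a * normalPart g u (barHessPlus g k u v) x) ^ 2) / gradNorm g u x
    + (normSq2 g (barHessMinus g k u v) x
      - (a * normalPart g v (barHessMinus g k u v) x) ^ 2) / gradNorm g v x

/-! Spherically symmetric initial data. -/

/-- A smooth initial data set `(M, g, k)` on `M = {x ∈ ℝ³ : |x| > inner}`, invariant under the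
action of `SO(3)`: `A^* g = g` and `A^* k = k` for every rotation `A`. -/
structure SphericalIDS where
  inner : ℝ
  inner_nonneg : 0 ≤ inner
  g : Tensor2 3
  k : Tensor2 3
  g_smooth : ∀ i j, ContDiffOn ℝ ∞ (fun x => g x i j) {x | inner < ‖x‖}
  k_smooth : ∀ i j, ContDiffOn ℝ ∞ (fun x => k x i j) {x | inner < ‖x‖}
  g_posDef : ∀ x, inner < ‖x‖ → (g x).PosDef
  k_symm : ∀ x, inner < ‖x‖ → (k x).IsSymm
  g_inv : ∀ A ∈ Matrix.specialOrthogonalGroup (Fin 3) ℝ, ∀ x : Pt 3, inner < ‖x‖ →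
    A.transpose * g (WithLp.toLp 2 (A.mulVec x.ofLp)) * A = g x
  k_inv : ∀ A ∈ Matrix.specialOrthogonalGroup (Fin 3) ℝ, ∀ x : Pt 3, inner < ‖x‖ →
    A.transpose * k (WithLp.toLp 2 (A.mulVec x.ofLp)) * A = k x

namespace SphericalIDS

variable (D : SphericalIDS)

/-- `tr_Σ k` for the symmetric sphere `Σ` through `x`. -/
def trSphere (x : Pt 3) : ℝ := tangTrace D.g (fun y => ‖y‖) D.k x

/-- The future null expansion `θ₊ = H + tr_Σ k` of the symmetric sphere through `x`, with respect
to the outward normal. -/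
def thetaPlus (x : Pt 3) : ℝ := meanCurv D.g (fun y => ‖y‖) x + D.trSphere x

/-- The past null expansion `θ₋ = H - tr_Σ k` of the symmetric sphere through `x`. -/
def thetaMinus (x : Pt 3) : ℝ := meanCurv D.g (fun y => ‖y‖) x - D.trSphere x

/-- The sphere `|x| = r` is marginally outer trapped. -/
def IsMOTS (r : ℝ) : Prop := ∀ x : Pt 3, ‖x‖ = r → D.thetaPlus x = 0

/-- The sphere `|x| = r` is marginally inner trapped. -/
def IsMITS (r : ℝ) : Prop := ∀ x : Pt 3, ‖x‖ = r → D.thetaMinus x = 0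

/-- The sphere `|x| = r` is untrapped. -/
def IsUntrapped (r : ℝ) : Prop := ∀ x : Pt 3, ‖x‖ = r → 0 < D.thetaPlus x ∧ 0 < D.thetaMinus x

/-- The sphere `|x| = r₀` in `M` is an outermost apparent horizon: it is a MOTS or a MITS, and it is
not enclosed by any other symmetric MOTS or MITS. -/
def IsOutermostHorizon (r₀ : ℝ) : Prop :=
  D.inner < r₀ ∧ (D.IsMOTS r₀ ∨ D.IsMITS r₀) ∧ ∀ r, r₀ < r → ¬ D.IsMOTS r ∧ ¬ D.IsMITS r

/-- The dominant energy condition `μ ≥ |J|` on and outside the sphere `|x| = r₀`. -/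
def DECOutside (r₀ : ℝ) : Prop :=
  ∀ x : Pt 3, r₀ ≤ ‖x‖ → momentumNorm D.g D.k x ≤ energyDensity D.g D.k x

/-- The area of the sphere `|x| = r`. -/
def area (r : ℝ) : ℝ := sphereIntegral D.g r fun _ => 1

/-- `∫_Σ θ₊ θ₋ dA` for the sphere `|x| = r`. -/
def expansionIntegral (r : ℝ) : ℝ := sphereIntegral D.g r fun x => D.thetaPlus x * D.thetaMinus x

/-- The spacetime Hawking energy `√(|Σ|/16π) (1 - (1/16π) ∫_Σ θ₊θ₋ dA)` of the sphere `|x| = r`. -/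
def hawkingMass (r : ℝ) : ℝ :=
  Real.sqrt (D.area r / (16 * Real.pi)) * (1 - 1 / (16 * Real.pi) * D.expansionIntegral r)

/-- The speed `|∂_τ (τ n)|_g` of the radial path `τ ↦ τ n`, so that its arclength element is
`dρ = radialSpeed n τ dτ`. For a unit vector `n` this path is orthogonal to the symmetric spheres
and, by symmetry, its arclength is the distance between them. -/
def radialSpeed (n : Pt 3) (τ : ℝ) : ℝ := Real.sqrt (ev D.g (τ • n) n.ofLp n.ofLp)

/-- `∫ F dρ` along the radial path through `x`, from the sphere `|x| = r₀` to `x`, with respect to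
arclength `dρ`. -/
def radialIntegral (r₀ : ℝ) (F : Pt 3 → ℝ) (x : Pt 3) : ℝ :=
  ∫ τ in r₀..‖x‖, F (τ • (‖x‖⁻¹ • x)) * D.radialSpeed (‖x‖⁻¹ • x) τ

/-- Asymptotic flatness: `g - δ = O₂(|x|^{-q})` and `k = O₁(|x|^{-q-1})` for some `q > 1/2`. -/
def IsAsymptoticallyFlat : Prop :=
  ∃ q C R : ℝ, 1 / 2 < q ∧ ∀ x : Pt 3, D.inner < ‖x‖ → R ≤ ‖x‖ → ∀ i j l m : Fin 3,
    |D.g x i j - (1 : Matrix (Fin 3) (Fin 3) ℝ) i j| ≤ C * ‖x‖ ^ (-q) ∧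
    |pd l (fun y => D.g y i j) x| ≤ C * ‖x‖ ^ (-q - 1) ∧
    |pd m (pd l (fun y => D.g y i j)) x| ≤ C * ‖x‖ ^ (-q - 2) ∧
    |D.k x i j| ≤ C * ‖x‖ ^ (-q - 1) ∧
    |pd l (fun y => D.k y i j) x| ≤ C * ‖x‖ ^ (-q - 2)

/-- The Euclidean metric. -/
def flat : Tensor2 3 := fun _ => 1

/-- `E = lim (1/16π) ∫_{S_r} ∑ (g_{ij,i} - g_{ii,j}) υʲ dA` is the ADM energy. -/
def HasADMEnergy (E : ℝ) : Prop :=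
  Tendsto (fun r : ℝ => 1 / (16 * Real.pi) * sphereIntegral flat r fun x =>
    ∑ i, ∑ j, (pd i (fun y => D.g y i j) x - pd j (fun y => D.g y i i) x) * (x j / ‖x‖))
    atTop (𝓝 E)

/-- `Pᵢ = lim (1/8π) ∫_{S_r} (k_{ij} - (tr k) g_{ij}) υʲ dA` is the ADM momentum. -/
def HasADMMomentum (P : Pt 3) : Prop :=
  ∀ i, Tendsto (fun r : ℝ => 1 / (8 * Real.pi) * sphereIntegral flat r fun x =>
    ∑ j, (D.k x i j - tr D.g D.k x * D.g x i j) * (x j / ‖x‖)) atTop (𝓝 (P i))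

end SphericalIDS

end SphIDS

end

/-!
In spherical symmetry every quantity in the theorem is a function of one variable. An
`SO(3)`-invariant symmetric 2-tensor has the form `A (δ - n ⊗ n) + C n ⊗ n` with `n = x / |x|`
(`eq_sphTensor_of_invariant`), so that `g = h² dr² + σ² dΩ²`, where `σ` is the area radius, and `k`
has the value `κ` on unit vectors tangent to the symmetric spheres and `λ` on their unit normal
(`SphericalIDS.isWarped`, `SphericalIDS.isFrameTensor`). The Christoffel symbols of such a metric
have the shape `P (xᵢ δⱼₘ + xⱼ δᵢₘ) + xₘ (Q δᵢⱼ + S xᵢ xⱼ)`, and curvature, Hessians and divergences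
are computed from it. With `d/dρ = h⁻¹ d/dr` this gives `θ± = 2 σ_ρ / σ ± 2 κ`.

The solution of the system is `s = u + v = σ / 2`, `w = v - u = ∫ κ s dρ`. Then
`|∇v| = v_ρ = θ₊ s / 4` and `|∇u| = u_ρ = θ₋ s / 4`: these are positive outside an outermost horizon,
since `θ±` has no zero there and is positive somewhere (`SphericalIDS.expansion_pos`). The tensors
`∇̄²₊ u` and `∇̄²₋ v` have no tangential part (`IsProfile.barHessPlus_eq`,
`IsProfile.barHessMinus_eq`), so the system with `a = 1` holds and the Hessian terms vanish.

The Hawking energy is `m = (σ / 2) (1 - σ_ρ² + σ² κ²)`, and the heart of the matter is the identity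
`σ² (μ (|∇u| + |∇v|) + ⟨J, ∇u - ∇v⟩) = dm/dρ` (`IsProfile.matterTerm_eq`), whose left side is
nonnegative by the dominant energy condition (`IsProfile.matterTerm_nonneg`). The field `Y` is
radial with flux density `-s θ₊ θ₋ / 2`, whence `div Y = 2 (m - σ / 2)_ρ / σ²`, while the
symmetric spheres have Gaussian curvature `1 / σ²` (`IsWarped.hasGaussCurvAt`). All volume integrals
are thus integrals of derivatives (`IsWarped.shellIntegral_of_deriv`).

For the Penrose inequality, `m = σ / 2` on the horizon. In an asymptotically flat end the
terms of `m` that are quadratic in the decaying quantities are `O(r^{1 - 2q})`, and the linear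
terms are, up to factors tending to `1`, the flux integral of the ADM energy, so `m` tends to `E`
(`SphericalIDS.tendsto_hawkingMass`). The ADM momentum vanishes, because its flux integrand is a
multiple of a linear function on each sphere.
-/

noncomputable section

namespace SphIDS

/-! ### Spherically symmetric 2-tensors at a point -/

/-- The symmetric matrix `A (δ - n ⊗ n) + C n ⊗ n`, `n = x / |x|`: the components at `x` of a
spherically symmetric 2-tensor with tangential value `A` and radial value `C`. -/
def sphTensor (A C : ℝ) (x : Pt 3) : Matrix (Fin 3) (Fin 3) ℝ := Matrix.of fun i j =>
  A * (if i = j then 1 else 0) + (C - A) / ‖x‖ ^ 2 * (x i * x j)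

lemma norm_sq_coords (x : Pt 3) : ‖x‖ ^ 2 = x 0 ^ 2 + x 1 ^ 2 + x 2 ^ 2 := by
  rw [EuclideanSpace.real_norm_sq_eq, Fin.sum_univ_three]

lemma sphTensor_apply (A C : ℝ) (x : Pt 3) (i j : Fin 3) :
    sphTensor A C x i j = A * (if i = j then 1 else 0) + (C - A) / ‖x‖ ^ 2 * (x i * x j) := rfl

lemma sphTensor_symm (A C : ℝ) (x : Pt 3) (i j : Fin 3) :
    sphTensor A C x i j = sphTensor A C x j i := by
  simp only [sphTensor_apply, eq_comm (a := i), mul_comm (x i)]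

lemma sum_mul_self_coords (x : Pt 3) : ∑ i, x i * x i = ‖x‖ ^ 2 := by
  rw [norm_sq_coords, Fin.sum_univ_three]
  ring

lemma sphTensor_sum_mul (A C : ℝ) {x : Pt 3} (hx : x ≠ 0) (i : Fin 3) :
    ∑ j, sphTensor A C x i j * x j = C * x i := by
  have hr : ‖x‖ ^ 2 ≠ 0 := by simpa using hx
  have h : ∑ j, sphTensor A C x i j * x j
      = A * x i + (C - A) / ‖x‖ ^ 2 * x i * ∑ j, x j * x j := by
    simp only [sphTensor_apply, Finset.mul_sum, add_mul, Finset.sum_add_distrib]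
    simp [mul_assoc]
  rw [h, sum_mul_self_coords]
  field_simp
  ring

lemma sphTensor_mul (A C A' C' : ℝ) {x : Pt 3} (hx : x ≠ 0) :
    sphTensor A C x * sphTensor A' C' x = sphTensor (A * A') (C * C') x := by
  have hr : ‖x‖ ^ 2 ≠ 0 := by simpa using hx
  ext i j
  have h : (sphTensor A C x * sphTensor A' C' x) i j
      = A' * sphTensor A C x i j + (C' - A') / ‖x‖ ^ 2 * x j * ∑ l, sphTensor A C x i l * x l := by
    rw [Matrix.mul_apply, Finset.mul_sum]
    simp_rw [sphTensor_apply A' C', mul_add, Finset.sum_add_distrib]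
    congr 1
    · simp [mul_comm]
    · exact Finset.sum_congr rfl fun l _ => by ring
  rw [h, sphTensor_sum_mul A C hx, sphTensor_apply, sphTensor_apply]
  field_simp
  ring

lemma sphTensor_one {x : Pt 3} : sphTensor 1 1 x = 1 := by
  ext i j
  simp [sphTensor_apply, Matrix.one_apply]

lemma sphTensor_inv {A C : ℝ} (hA : A ≠ 0) (hC : C ≠ 0) {x : Pt 3} (hx : x ≠ 0) :
    (sphTensor A C x)⁻¹ = sphTensor A⁻¹ C⁻¹ x := by
  apply Matrix.inv_eq_right_inv
  rw [sphTensor_mul _ _ _ _ hx, mul_inv_cancel₀ hA, mul_inv_cancel₀ hC, sphTensor_one]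

lemma sphTensor_trace (A C : ℝ) {x : Pt 3} (hx : x ≠ 0) :
    (sphTensor A C x).trace = 2 * A + C := by
  have hr : ‖x‖ ^ 2 ≠ 0 := by simpa using hx
  have h : (sphTensor A C x).trace = 3 * A + (C - A) / ‖x‖ ^ 2 * ∑ j, x j * x j := by
    simp [Matrix.trace, sphTensor_apply, Finset.mul_sum, Finset.sum_add_distrib]
  rw [h, sum_mul_self_coords]
  field_simp
  ring

lemma sphTensor_det (A C : ℝ) {x : Pt 3} (hx : x ≠ 0) :
    (sphTensor A C x).det = A ^ 2 * C := by
  have hr : ‖x‖ ^ 2 ≠ 0 := by simpa using hx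
  have h : (sphTensor A C x).det
      = A ^ 3 + A ^ 2 * ((C - A) / ‖x‖ ^ 2) * (x 0 ^ 2 + x 1 ^ 2 + x 2 ^ 2) := by
    rw [Matrix.det_fin_three]
    simp [sphTensor_apply]
    ring
  rw [h, ← norm_sq_coords]
  field_simp
  ring

lemma sphTensor_ev_self (A C : ℝ) {x : Pt 3} (hx : x ≠ 0) (c : ℝ) :
    ∑ i, ∑ j, sphTensor A C x i j * (c * x i) * (c * x j) = C * c ^ 2 * ‖x‖ ^ 2 := by
  have h : ∑ i, ∑ j, sphTensor A C x i j * (c * x i) * (c * x j)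
      = ∑ i, c ^ 2 * x i * ∑ j, sphTensor A C x i j * x j := by
    refine Finset.sum_congr rfl fun i _ => ?_
    rw [Finset.mul_sum]
    exact Finset.sum_congr rfl fun j _ => by ring
  rw [h, ← sum_mul_self_coords, Finset.mul_sum]
  exact Finset.sum_congr rfl fun i _ => by rw [sphTensor_sum_mul A C hx]; ring

section pointwise

variable {g T : Tensor2 3} {a b A C : ℝ} {x : Pt 3}

lemma ginv_sphTensor (hx : x ≠ 0) (ha : a ≠ 0) (hb : b ≠ 0) (hg : g x = sphTensor a b x)
    (i j : Fin 3) : ginv g x i j = sphTensor a⁻¹ b⁻¹ x i j := by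
  rw [ginv, hg, sphTensor_inv ha hb hx]

lemma tr_sphTensor (hx : x ≠ 0) (ha : a ≠ 0) (hb : b ≠ 0) (hg : g x = sphTensor a b x)
    (hT : T x = sphTensor A C x) : tr g T x = 2 * (A / a) + C / b := by
  have h : tr g T x = (sphTensor a⁻¹ b⁻¹ x * sphTensor A C x).trace := by
    simp only [tr, Matrix.trace, Matrix.diag, Matrix.mul_apply, ginv_sphTensor hx ha hb hg, hT]
    exact Finset.sum_congr rfl fun i _ => Finset.sum_congr rfl fun j _ => by
      rw [sphTensor_symm A C x i j]
  rw [h, sphTensor_mul _ _ _ _ hx, sphTensor_trace _ _ hx]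
  ring

lemma normSq2_sphTensor (hx : x ≠ 0) (ha : a ≠ 0) (hb : b ≠ 0) (hg : g x = sphTensor a b x)
    (hT : T x = sphTensor A C x) : normSq2 g T x = 2 * (A / a) ^ 2 + (C / b) ^ 2 := by
  have h : normSq2 g T x =
      (sphTensor A C x * (sphTensor a⁻¹ b⁻¹ x * sphTensor A C x * sphTensor a⁻¹ b⁻¹ x)).trace := by
    simp only [normSq2, Matrix.trace, Matrix.diag, ginv_sphTensor hx ha hb hg, hT]
    refine Finset.sum_congr rfl fun i _ => ?_
    rw [Matrix.mul_apply]
    refine Finset.sum_congr rfl fun j _ => ?_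
    rw [sphTensor_mul _ _ _ _ hx, sphTensor_mul _ _ _ _ hx, sphTensor_symm _ _ x j i,
      ← sphTensor_mul _ _ _ _ hx, ← sphTensor_mul _ _ _ _ hx, Matrix.mul_apply, Finset.mul_sum,
      Finset.sum_comm]
    refine Finset.sum_congr rfl fun l _ => ?_
    rw [Matrix.mul_apply, Finset.sum_mul, Finset.mul_sum]
    exact Finset.sum_congr rfl fun m _ => by rw [sphTensor_symm _ _ x j l]; ring
  rw [h, sphTensor_mul _ _ _ _ hx, sphTensor_mul _ _ _ _ hx, sphTensor_mul _ _ _ _ hx,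
    sphTensor_trace _ _ hx]
  ring

end pointwise

/-! ### Rotations and the normal form of invariant tensors -/

/-- The point `(r, 0, 0)`. -/
def axisPt (r : ℝ) : Pt 3 := !₂[r, 0, 0]

lemma norm_axisPt {r : ℝ} (hr : 0 ≤ r) : ‖axisPt r‖ = r := by
  rw [← sq_eq_sq₀ (norm_nonneg _) hr, norm_sq_coords]
  simp [axisPt]

/-- Polar coordinates of a point of the plane, with an arbitrary angle at the origin. -/
lemma exists_polar (p q : ℝ) : ∃ ρ c s : ℝ, c ^ 2 + s ^ 2 = 1 ∧ p = ρ * c ∧ q = ρ * s ∧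
    ρ = Real.sqrt (p ^ 2 + q ^ 2) := by
  by_cases h : p ^ 2 + q ^ 2 = 0
  · have hp : p = 0 := by nlinarith [sq_nonneg p, sq_nonneg q]
    have hq : q = 0 := by nlinarith [sq_nonneg p, sq_nonneg q]
    exact ⟨0, 1, 0, by simp, by simp [hp], by simp [hq], by simp [h]⟩
  · have h0 : 0 < p ^ 2 + q ^ 2 := lt_of_le_of_ne (by positivity) (Ne.symm h)
    have hs := Real.sqrt_pos.2 h0
    refine ⟨√(p ^ 2 + q ^ 2), p / √(p ^ 2 + q ^ 2), q / √(p ^ 2 + q ^ 2), ?_, ?_, ?_, rfl⟩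
    · rw [div_pow, div_pow, Real.sq_sqrt h0.le]
      field_simp
    · field_simp
    · field_simp

/-- Every point is the image of a point on the positive first coordinate axis under a rotation. -/
lemma exists_rotation (x : Pt 3) : ∃ R ∈ Matrix.specialOrthogonalGroup (Fin 3) ℝ,
    WithLp.toLp 2 (R.mulVec (axisPt ‖x‖).ofLp) = x := by
  obtain ⟨ρ, c, s, h1, h2, h3, h4⟩ := exists_polar (x 0) (x 1)
  obtain ⟨r, c', s', h1', h2', h3', h4'⟩ := exists_polar ρ (x 2)
  have hr : r = ‖x‖ := by
    rw [h4', h4, Real.sq_sqrt (by positivity), ← norm_sq_coords, Real.sqrt_sq (norm_nonneg _)]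
  refine ⟨!![c' * c, -s, -s' * c; c' * s, c, -s' * s; s', 0, c'], ?_, ?_⟩
  · rw [Matrix.mem_specialOrthogonalGroup_iff, Matrix.mem_orthogonalGroup_iff]
    constructor
    · ext i j
      fin_cases i <;> fin_cases j <;>
        simp [Matrix.mul_apply, Fin.sum_univ_three]
      · linear_combination c ^ 2 * h1' + h1
      · linear_combination c * s * h1'
      · ring
      · linear_combination c * s * h1'
      · linear_combination s ^ 2 * h1' + h1
      · ring
      · ring
      · ring
      · linear_combination h1'
    · rw [Matrix.det_fin_three]
      simp
      linear_combination (c' ^ 2 + s' ^ 2) * h1 + h1'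
  · rw [← hr]
    ext i
    fin_cases i <;> simp [Matrix.mulVec, dotProduct, Fin.sum_univ_three, axisPt]
    · rw [h2, h2']; ring
    · rw [h3, h2']; ring
    · rw [h3']; ring

/-- A symmetric 2-tensor which is invariant under rotations is determined by its tangential and
radial values along a coordinate axis. -/
lemma eq_sphTensor_of_invariant {c : ℝ} (hc : 0 ≤ c) {T : Tensor2 3}
    (hsymm : ∀ x, c < ‖x‖ → (T x).IsSymm)
    (hinv : ∀ A ∈ Matrix.specialOrthogonalGroup (Fin 3) ℝ, ∀ x : Pt 3, c < ‖x‖ →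
      A.transpose * T (WithLp.toLp 2 (A.mulVec x.ofLp)) * A = T x) {x : Pt 3} (hx : c < ‖x‖) :
    T x = sphTensor (T (axisPt ‖x‖) 1 1) (T (axisPt ‖x‖) 0 0) x := by
  have hr : 0 < ‖x‖ := hc.trans_lt hx
  set r := ‖x‖ with hrdef
  have hax : c < ‖axisPt r‖ := by rwa [norm_axisPt hr.le]
  set G := T (axisPt r) with hG
  have hGs : ∀ i j, G i j = G j i := fun i j => (hsymm _ hax).apply j i
  -- The quarter turn about the axis fixes `axisPt r`, hence `G` is diagonal with `G 1 1 = G 2 2`.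
  have hq := hinv !![1, 0, 0; 0, 0, -1; 0, 1, 0] (by
    rw [Matrix.mem_specialOrthogonalGroup_iff, Matrix.mem_orthogonalGroup_iff]
    constructor
    · ext i j
      fin_cases i <;> fin_cases j <;>
        simp [Matrix.mul_apply, Fin.sum_univ_three]
    · simp [Matrix.det_fin_three]) (axisPt r) hax
  have hfix : (WithLp.toLp 2 ((!![1, 0, 0; 0, 0, -1; 0, 1, 0] : Matrix (Fin 3) (Fin 3) ℝ).mulVec
      (axisPt r).ofLp) : Pt 3) = axisPt r := by
    ext i
    fin_cases i <;> simp [Matrix.mulVec, dotProduct, Fin.sum_univ_three, axisPt]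
  rw [hfix, ← hG] at hq
  have e01 := congrFun (congrFun hq 0) 1
  have e02 := congrFun (congrFun hq 0) 2
  have e12 := congrFun (congrFun hq 1) 2
  have e11 := congrFun (congrFun hq 1) 1
  simp [Matrix.mul_apply, Fin.sum_univ_three] at e01 e02 e12 e11
  have h12 := hGs 1 2
  have hGd : G = sphTensor (G 1 1) (G 0 0) (axisPt r) := by
    have hr2 : ‖axisPt r‖ ^ 2 = r ^ 2 := by rw [norm_axisPt hr.le]
    ext i j
    rw [sphTensor_apply, hr2]
    fin_cases i <;> fin_cases j <;> simp [axisPt] <;>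
      first
        | (field_simp; ring)
        | linarith [hGs 0 1, hGs 0 2, hGs 1 2]
  obtain ⟨R, hR, hRx⟩ := exists_rotation x
  have hRR : R * R.transpose = 1 := by
    have := (Matrix.mem_orthogonalGroup_iff (Fin 3) ℝ).1
      ((Matrix.mem_specialOrthogonalGroup_iff (A := R)).1 hR).1
    simpa [Matrix.star_eq_conjTranspose] using this
  have hmain := hinv R hR (axisPt r) hax
  rw [← hrdef] at hRx
  rw [hRx, ← hG] at hmain
  have hTx : T x = R * G * R.transpose := by
    calc T x = (R * R.transpose) * T x * (R * R.transpose) := by rw [hRR]; simp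
      _ = R * (R.transpose * T x * R) * R.transpose := by simp only [Matrix.mul_assoc]
      _ = R * G * R.transpose := by rw [hmain]
  have hxi : ∀ i, x i = R i 0 * r := fun i => by
    conv_lhs => rw [← hRx]
    simp [Matrix.mulVec, dotProduct, Fin.sum_univ_three, axisPt]
  have hrow : ∀ i j, (if i = j then (1 : ℝ) else 0)
      = R i 0 * R j 0 + R i 1 * R j 1 + R i 2 * R j 2 := fun i j => by
    have := congrFun (congrFun hRR i) j
    simp only [Matrix.mul_apply, Fin.sum_univ_three, Matrix.transpose_apply,
      Matrix.one_apply] at this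
    exact this.symm
  rw [hTx]
  ext i j
  rw [sphTensor_apply, hrow, hxi i, hxi j, ← hrdef]
  conv_lhs => rw [hGd]
  have hr2 : ‖axisPt r‖ ^ 2 = r ^ 2 := by rw [norm_axisPt hr.le]
  simp only [Matrix.mul_apply, Fin.sum_univ_three, Matrix.transpose_apply, sphTensor_apply, hr2]
  simp [axisPt]
  field_simp
  ring

/-! ### Partial derivatives of radial expressions -/

section pd

variable {n : ℕ} {x : Pt n} {f h : Pt n → ℝ}

lemma pd_congr (hfh : f =ᶠ[𝓝 x] h) (i : Fin n) : pd i f x = pd i h x := by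
  rw [pd, pd, hfh.fderiv_eq]

lemma pd_const (c : ℝ) (i : Fin n) : pd i (fun _ => c) x = 0 := by simp [pd]

lemma pd_coord (i j : Fin n) : pd i (fun y => y j) x = if i = j then 1 else 0 := by
  have h : HasFDerivAt (fun y : Pt n => y j) (EuclideanSpace.proj (𝕜 := ℝ) j) x :=
    (EuclideanSpace.proj (𝕜 := ℝ) j).hasFDerivAt
  rw [pd, h.fderiv]
  simp [eq_comm]

lemma differentiableAt_coord (j : Fin n) : DifferentiableAt ℝ (fun y : Pt n => y j) x :=
  (EuclideanSpace.proj (𝕜 := ℝ) j).differentiableAt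

lemma pd_add (hf : DifferentiableAt ℝ f x) (hh : DifferentiableAt ℝ h x) (i : Fin n) :
    pd i (fun y => f y + h y) x = pd i f x + pd i h x := by
  simp [pd, fderiv_fun_add hf hh]

lemma pd_mul (hf : DifferentiableAt ℝ f x) (hh : DifferentiableAt ℝ h x) (i : Fin n) :
    pd i (fun y => f y * h y) x = f x * pd i h x + pd i f x * h x := by
  simp [pd, fderiv_fun_mul hf hh, mul_comm (h x)]

lemma pd_mul_const (hf : DifferentiableAt ℝ f x) (c : ℝ) (i : Fin n) :
    pd i (fun y => f y * c) x = pd i f x * c := by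
  rw [pd_mul hf (differentiableAt_const c), pd_const]; ring

variable {F : ℝ → ℝ} {F' : ℝ}

lemma hasFDerivAt_radial (hx : x ≠ 0) (hF : HasDerivAt F F' ‖x‖) :
    HasFDerivAt (fun y : Pt n => F ‖y‖) (F' • fderiv ℝ (fun y : Pt n => ‖y‖) x) x :=
  hF.comp_hasFDerivAt x ((contDiffAt_norm ℝ hx (n := 1)).differentiableAt (by simp)).hasFDerivAt

lemma differentiableAt_radial (hx : x ≠ 0) (hF : HasDerivAt F F' ‖x‖) :
    DifferentiableAt ℝ (fun y : Pt n => F ‖y‖) x := (hasFDerivAt_radial hx hF).differentiableAt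

lemma pd_norm (hx : x ≠ 0) (i : Fin n) : pd i (fun y => ‖y‖) x = x i / ‖x‖ := by
  have hd : DifferentiableAt ℝ (fun y : Pt n => ‖y‖) x :=
    (contDiffAt_norm ℝ hx (n := 1)).differentiableAt (by simp)
  have h1 : pd i (fun y => ‖y‖ * ‖y‖) x = 2 * x i := by
    have : (fun y : Pt n => ‖y‖ * ‖y‖) = fun y => ‖y‖ ^ 2 := by ext; ring
    rw [this, pd, fderiv_norm_sq_apply]
    simp [EuclideanSpace.inner_single_right]
  rw [pd_mul hd hd] at h1
  have : ‖x‖ ≠ 0 := by simpa using hx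
  field_simp
  linarith

lemma pd_radial (hx : x ≠ 0) (hF : HasDerivAt F F' ‖x‖) (i : Fin n) :
    pd i (fun y => F ‖y‖) x = F' / ‖x‖ * x i := by
  have h := pd_norm hx i
  rw [pd] at h
  rw [pd, (hasFDerivAt_radial hx hF).fderiv]
  simp only [smul_apply, smul_eq_mul, h]
  ring

lemma pd_radial_mul_coord (hx : x ≠ 0) (hF : HasDerivAt F F' ‖x‖) (i j : Fin n) :
    pd i (fun y => F ‖y‖ * y j) x
      = F ‖x‖ * (if i = j then 1 else 0) + F' / ‖x‖ * (x i * x j) := by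
  rw [pd_mul (differentiableAt_radial hx hF) (differentiableAt_coord j), pd_coord,
    pd_radial hx hF]
  ring

lemma pd_radial_mul_coord_mul_coord (hx : x ≠ 0) (hF : HasDerivAt F F' ‖x‖) (l i j : Fin n) :
    pd l (fun y => F ‖y‖ * (y i * y j)) x
      = F ‖x‖ * ((if l = i then 1 else 0) * x j + (if l = j then 1 else 0) * x i)
        + F' / ‖x‖ * (x l * x i * x j) := by
  rw [pd_mul (differentiableAt_radial hx hF)
    ((differentiableAt_coord i).fun_mul (differentiableAt_coord j)), pd_radial hx hF,
    pd_mul (differentiableAt_coord i) (differentiableAt_coord j), pd_coord, pd_coord]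
  ring

/-- The partial derivatives of the components of a tensor `A(r) δ + B(r) x ⊗ x`. -/
lemma pd_tensor {A B : ℝ → ℝ} {A' B' : ℝ} (hx : x ≠ 0) (hA : HasDerivAt A A' ‖x‖)
    (hB : HasDerivAt B B' ‖x‖) (l i j : Fin n) :
    pd l (fun y => A ‖y‖ * (if i = j then 1 else 0) + B ‖y‖ * (y i * y j)) x
      = A' / ‖x‖ * x l * (if i = j then 1 else 0)
        + (B ‖x‖ * ((if l = i then 1 else 0) * x j + (if l = j then 1 else 0) * x i)
        + B' / ‖x‖ * (x l * x i * x j)) := by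
  have dA := differentiableAt_radial hx hA
  have dB := differentiableAt_radial hx hB
  rw [pd_add (dA.mul_const _)
    (dB.fun_mul ((differentiableAt_coord i).fun_mul (differentiableAt_coord j))),
    pd_mul_const dA, pd_radial hx hA, pd_radial_mul_coord_mul_coord hx hB]

end pd

/-! ### The Levi-Civita connection and the curvature of `α(r) δ + β(r) x ⊗ x` -/

/-- The spherically symmetric expression
`P (xᵢ δⱼₘ + xⱼ δᵢₘ) + xₘ (Q δᵢⱼ + S xᵢ xⱼ)` for the Christoffel symbol `Γᵐᵢⱼ`. -/
def connForm (P Q S : ℝ) (x : Pt 3) (m i j : Fin 3) : ℝ :=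
  P * (x i * (if j = m then 1 else 0) + x j * (if i = m then 1 else 0))
    + x m * (Q * (if i = j then 1 else 0) + S * (x i * x j))

variable {x : Pt 3}

lemma christoffel_of_tensor {g : Tensor2 3} {α β : ℝ → ℝ} {α' β' p q : ℝ} (hx : x ≠ 0)
    (hg : ∀ i j, (fun y => g y i j) =ᶠ[𝓝 x]
      fun y => α ‖y‖ * (if i = j then 1 else 0) + β ‖y‖ * (y i * y j))
    (hα : HasDerivAt α α' ‖x‖) (hβ : HasDerivAt β β' ‖x‖)
    (hinv : ∀ i j, ginv g x i j = p * (if i = j then 1 else 0) + q * (x i * x j))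
    (m i j : Fin 3) :
    christoffel g m i j x = connForm (p * (α' / ‖x‖) / 2)
      ((p + q * ‖x‖ ^ 2) * (β ‖x‖ - α' / ‖x‖ / 2))
      (q * (α' / ‖x‖) + (p + q * ‖x‖ ^ 2) * (β' / ‖x‖) / 2) x m i j := by
  have hp : ∀ l i j, pd l (fun y => g y i j) x = α' / ‖x‖ * x l * (if i = j then 1 else 0)
        + (β ‖x‖ * ((if l = i then 1 else 0) * x j + (if l = j then 1 else 0) * x i)
        + β' / ‖x‖ * (x l * x i * x j)) := fun l i j => by
    rw [pd_congr (hg i j), pd_tensor hx hα hβ]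
  simp only [christoffel, hp, hinv, connForm]
  rw [norm_sq_coords]
  generalize α' / ‖x‖ = a1
  generalize β' / ‖x‖ = b1
  generalize β ‖x‖ = b
  fin_cases m <;> fin_cases i <;> fin_cases j <;> simp [Fin.sum_univ_three] <;> ring

lemma pd_connForm {P Q S : ℝ → ℝ} {P' Q' S' : ℝ} (hx : x ≠ 0) (hP : HasDerivAt P P' ‖x‖)
    (hQ : HasDerivAt Q Q' ‖x‖) (hS : HasDerivAt S S' ‖x‖) (l m i j : Fin 3) :
    pd l (fun y => connForm (P ‖y‖) (Q ‖y‖) (S ‖y‖) y m i j) x =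
      connForm (P' / ‖x‖) (Q' / ‖x‖) (S' / ‖x‖) x m i j * x l
      + P ‖x‖ * ((if l = i then 1 else 0) * (if j = m then 1 else 0)
          + (if l = j then 1 else 0) * (if i = m then 1 else 0))
      + (if l = m then 1 else 0) * (Q ‖x‖ * (if i = j then 1 else 0) + S ‖x‖ * (x i * x j))
      + x m * S ‖x‖ * ((if l = i then 1 else 0) * x j + (if l = j then 1 else 0) * x i) := by
  have dP := differentiableAt_radial hx hP
  have dQ := differentiableAt_radial hx hQ
  have dS := differentiableAt_radial hx hS
  have dc : ∀ j, DifferentiableAt ℝ (fun y : Pt 3 => y j) x := fun j => differentiableAt_coord j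
  have d1 : DifferentiableAt ℝ (fun y : Pt 3 =>
      y i * (if j = m then 1 else 0) + y j * (if i = m then (1 : ℝ) else 0)) x :=
    ((dc i).mul_const _).add ((dc j).mul_const _)
  have d2 : DifferentiableAt ℝ (fun y : Pt 3 =>
      Q ‖y‖ * (if i = j then 1 else 0) + S ‖y‖ * (y i * y j)) x :=
    (dQ.mul_const _).add (dS.mul ((dc i).mul (dc j)))
  simp only [connForm]
  rw [pd_add (dP.fun_mul d1) ((dc m).fun_mul d2), pd_mul dP d1, pd_mul (dc m) d2, pd_tensor hx hQ hS,
    pd_radial hx hP, pd_add ((dc i).mul_const _) ((dc j).mul_const _), pd_mul_const (dc i),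
    pd_mul_const (dc j), pd_coord, pd_coord, pd_coord]
  ring

/-- The Ricci tensor is `X δ + Z x ⊗ x` with explicit `X` and `Z`. -/
lemma ricci_of_connForm {g : Tensor2 3} {P Q S : ℝ → ℝ} {P' Q' S' : ℝ} (hx : x ≠ 0)
    (hΓ : ∀ m i j, christoffel g m i j =ᶠ[𝓝 x]
      fun y => connForm (P ‖y‖) (Q ‖y‖) (S ‖y‖) y m i j)
    (hP : HasDerivAt P P' ‖x‖) (hQ : HasDerivAt Q Q' ‖x‖) (hS : HasDerivAt S S' ‖x‖)
    (i j : Fin 3) :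
    ricci g i j x =
      (-2 * P ‖x‖ + 2 * Q ‖x‖ + ‖x‖ ^ 2 * (Q' / ‖x‖) - ‖x‖ ^ 2 * S ‖x‖
        + ‖x‖ ^ 2 * Q ‖x‖ * (2 * P ‖x‖ + Q ‖x‖ + ‖x‖ ^ 2 * S ‖x‖)) * (if i = j then 1 else 0)
      + (-2 * (P' / ‖x‖) + 3 * S ‖x‖ - Q' / ‖x‖ + 2 * P ‖x‖ ^ 2 - Q ‖x‖ ^ 2
        + ‖x‖ ^ 2 * S ‖x‖ * (2 * P ‖x‖ - Q ‖x‖)) * (x i * x j) := by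
  have hΓx : ∀ m i j, christoffel g m i j x = connForm (P ‖x‖) (Q ‖x‖) (S ‖x‖) x m i j :=
    fun m i j => (hΓ m i j).eq_of_nhds
  have hd : ∀ l m i j, pd l (christoffel g m i j) x = _ := fun l m i j =>
    (pd_congr (hΓ m i j) l).trans (pd_connForm hx hP hQ hS l m i j)
  simp only [ricci, hd, hΓx, connForm]
  rw [norm_sq_coords]
  generalize P' / ‖x‖ = P1
  generalize Q' / ‖x‖ = Q1
  generalize S' / ‖x‖ = S1
  generalize P ‖x‖ = P0
  generalize Q ‖x‖ = Q0
  generalize S ‖x‖ = S0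
  fin_cases i <;> fin_cases j <;> simp [Fin.sum_univ_three] <;> ring

/-- The Hessian of a radial function. -/
lemma hess_of_connForm {g : Tensor2 3} {P Q S : ℝ} {f : Pt 3 → ℝ} {F' : ℝ → ℝ} {F'' : ℝ}
    (hx : x ≠ 0) (hΓ : ∀ m i j, christoffel g m i j x = connForm P Q S x m i j)
    (hf : ∀ᶠ y in 𝓝 x, ∀ i, pd i f y = F' ‖y‖ * y i)
    (hF' : HasDerivAt F' F'' ‖x‖) (i j : Fin 3) :
    hess g f x i j = F' ‖x‖ * (1 - ‖x‖ ^ 2 * Q) * (if i = j then 1 else 0)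
      + (F'' / ‖x‖ - F' ‖x‖ * (2 * P + ‖x‖ ^ 2 * S)) * (x i * x j) := by
  have h1 : pd i (pd j f) x = _ :=
    (pd_congr (hf.mono fun y hy => hy j) i).trans (pd_radial_mul_coord hx hF' i j)
  simp only [hess, Matrix.of_apply, h1, hΓ, hf.self_of_nhds, connForm]
  rw [norm_sq_coords]
  generalize F'' / ‖x‖ = F2
  fin_cases i <;> fin_cases j <;> simp [Fin.sum_univ_three] <;> ring

/-- The divergence of a radial vector field. -/
lemma diverg_of_connForm {g : Tensor2 3} {P Q S : ℝ} {X : Pt 3 → Fin 3 → ℝ} {ξ : ℝ → ℝ} {ξ' : ℝ}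
    (hx : x ≠ 0) (hΓ : ∀ m i j, christoffel g m i j x = connForm P Q S x m i j)
    (hX : ∀ᶠ y in 𝓝 x, ∀ i, X y i = ξ ‖y‖ * y i) (hξ : HasDerivAt ξ ξ' ‖x‖) :
    diverg g X x = 3 * ξ ‖x‖ + ‖x‖ ^ 2 * (ξ' / ‖x‖)
      + ξ ‖x‖ * ‖x‖ ^ 2 * (4 * P + Q + ‖x‖ ^ 2 * S) := by
  have h1 : ∀ i, pd i (fun y => X y i) x = _ := fun i =>
    (pd_congr (hX.mono fun y hy => hy i) i).trans (pd_radial_mul_coord hx hξ i i)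
  simp only [diverg, h1, hΓ, hX.self_of_nhds, connForm]
  rw [norm_sq_coords]
  generalize ξ' / ‖x‖ = F2
  simp [Fin.sum_univ_three]
  ring

/-- The divergence of a tensor `A(r) δ + B(r) x ⊗ x`. -/
lemma diverg2_of_connForm {g T : Tensor2 3} {P Q S p q : ℝ} {A B : ℝ → ℝ} {A' B' : ℝ}
    (hx : x ≠ 0) (hΓ : ∀ m i j, christoffel g m i j x = connForm P Q S x m i j)
    (hinv : ∀ i j, ginv g x i j = p * (if i = j then 1 else 0) + q * (x i * x j))
    (hT : ∀ i j, (fun y => T y i j) =ᶠ[𝓝 x]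
      fun y => A ‖y‖ * (if i = j then 1 else 0) + B ‖y‖ * (y i * y j))
    (hA : HasDerivAt A A' ‖x‖) (hB : HasDerivAt B B' ‖x‖) (m : Fin 3) :
    diverg2 g T x m =
      ((p + q * ‖x‖ ^ 2) * (A' / ‖x‖ + B' / ‖x‖ * ‖x‖ ^ 2) + B ‖x‖ * (4 * p + 2 * q * ‖x‖ ^ 2)
      - (A ‖x‖ + B ‖x‖ * ‖x‖ ^ 2) *
        (p * (2 * P + 3 * Q + S * ‖x‖ ^ 2) + q * ‖x‖ ^ 2 * (2 * P + Q + S * ‖x‖ ^ 2))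
      - A ‖x‖ * (p * (4 * P + Q + S * ‖x‖ ^ 2) + q * ‖x‖ ^ 2 * (2 * P + Q + S * ‖x‖ ^ 2))
      - B ‖x‖ * ‖x‖ ^ 2 * (p + q * ‖x‖ ^ 2) * (2 * P + Q + S * ‖x‖ ^ 2)) * x m := by
  have hTx : ∀ i j, T x i j = A ‖x‖ * (if i = j then 1 else 0) + B ‖x‖ * (x i * x j) :=
    fun i j => (hT i j).eq_of_nhds
  have hd : ∀ l i j, pd l (fun y => T y i j) x = _ := fun l i j =>
    (pd_congr (hT i j) l).trans (pd_tensor hx hA hB l i j)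
  simp only [diverg2, covDeriv2, hd, hΓ, hTx, hinv, connForm]
  rw [norm_sq_coords]
  generalize A' / ‖x‖ = A1
  generalize B' / ‖x‖ = B1
  generalize A ‖x‖ = A0
  generalize B ‖x‖ = B0
  fin_cases m <;> simp [Fin.sum_univ_three] <;> ring

/-! ### Warped product metrics `h² dr² + σ² dΩ²` -/

section smooth

variable {c r : ℝ} {F : ℝ → ℝ}

lemma hasDerivAt_of_contDiffOn_Ioi (hF : ContDiffOn ℝ ∞ F (Set.Ioi c)) (hr : c < r) :
    HasDerivAt F (deriv F r) r :=
  ((hF.contDiffAt (Ioi_mem_nhds hr)).differentiableAt (by simp)).hasDerivAt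

lemma contDiffOn_deriv_Ioi (hF : ContDiffOn ℝ ∞ F (Set.Ioi c)) :
    ContDiffOn ℝ ∞ (deriv F) (Set.Ioi c) :=
  ((contDiffOn_infty_iff_deriv_of_isOpen isOpen_Ioi).1 hF).2

lemma eventually_lt_norm {n : ℕ} {x : Pt n} (hx : c < ‖x‖) : ∀ᶠ y in 𝓝 x, c < ‖y‖ :=
  continuous_norm.continuousAt.eventually (lt_mem_nhds hx)

end smooth

/-- On `{|x| > c}` the metric is the warped product `h(r)² dr² + σ(r)² dΩ²`: `σ(r)` is the area
radius of the sphere `|x| = r`, and `h` is the radial speed. -/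
structure IsWarped (c : ℝ) (g : Tensor2 3) (σ h : ℝ → ℝ) : Prop where
  nonneg : 0 ≤ c
  smooth_radius : ContDiffOn ℝ ∞ σ (Set.Ioi c)
  smooth_speed : ContDiffOn ℝ ∞ h (Set.Ioi c)
  radius_pos : ∀ r, c < r → 0 < σ r
  speed_pos : ∀ r, c < r → 0 < h r
  eq_sphTensor : ∀ x : Pt 3, c < ‖x‖ → g x = sphTensor ((σ ‖x‖ / ‖x‖) ^ 2) (h ‖x‖ ^ 2) x

namespace IsWarped

variable {c : ℝ} {g T : Tensor2 3} {σ h F : ℝ → ℝ} {x : Pt 3} {A C : ℝ}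

/-- The coefficient `P` of the Christoffel symbols of `h² dr² + σ² dΩ²`, see `connForm`. -/
def connP (σ : ℝ → ℝ) (r : ℝ) : ℝ := (deriv σ r / σ r - r⁻¹) / r

/-- The coefficient `Q` of the Christoffel symbols of `h² dr² + σ² dΩ²`, see `connForm`. -/
def connQ (σ h : ℝ → ℝ) (r : ℝ) : ℝ := (1 - σ r * deriv σ r / (r * h r ^ 2)) / r ^ 2

/-- The coefficient `S` of the Christoffel symbols of `h² dr² + σ² dΩ²`, see `connForm`. -/
def connS (σ h : ℝ → ℝ) (r : ℝ) : ℝ :=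
  (deriv h r / (h r * r) - 2 * connP σ r - connQ σ h r) / r ^ 2

section basic

variable (hg : IsWarped c g σ h) (hx : c < ‖x‖)

include hg hx

lemma norm_pos : 0 < ‖x‖ := hg.nonneg.trans_lt hx

lemma ne_zero : x ≠ 0 := norm_pos_iff.1 (hg.norm_pos hx)

lemma tang_ne_zero : (σ ‖x‖ / ‖x‖) ^ 2 ≠ 0 :=
  (pow_pos (div_pos (hg.radius_pos _ hx) (hg.norm_pos hx)) 2).ne'

lemma rad_ne_zero : h ‖x‖ ^ 2 ≠ 0 := (pow_pos (hg.speed_pos _ hx) 2).ne'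

lemma ginv_eq (i j : Fin 3) :
    ginv g x i j = sphTensor ((σ ‖x‖ / ‖x‖) ^ 2)⁻¹ (h ‖x‖ ^ 2)⁻¹ x i j :=
  ginv_sphTensor (hg.ne_zero hx) (hg.tang_ne_zero hx) (hg.rad_ne_zero hx) (hg.eq_sphTensor x hx) i j

lemma tr_eq (hT : T x = sphTensor A C x) :
    tr g T x = 2 * (A * (‖x‖ / σ ‖x‖) ^ 2) + C / h ‖x‖ ^ 2 := by
  rw [tr_sphTensor (hg.ne_zero hx) (hg.tang_ne_zero hx) (hg.rad_ne_zero hx)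
    (hg.eq_sphTensor x hx) hT, div_eq_mul_inv A, ← inv_pow, inv_div]

lemma tr_of_components {X Z : ℝ}
    (hT : ∀ i j, T x i j = X * (if i = j then 1 else 0) + Z * (x i * x j)) :
    tr g T x = 2 * (X * (‖x‖ / σ ‖x‖) ^ 2) + (X + ‖x‖ ^ 2 * Z) / h ‖x‖ ^ 2 := by
  refine hg.tr_eq hx (Matrix.ext fun i j => ?_)
  rw [hT, sphTensor_apply, add_sub_cancel_left,
    mul_div_cancel_left₀ _ (pow_pos (hg.norm_pos hx) 2).ne']

lemma normSq2_eq (hT : T x = sphTensor A C x) :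
    normSq2 g T x = 2 * (A * (‖x‖ / σ ‖x‖) ^ 2) ^ 2 + (C / h ‖x‖ ^ 2) ^ 2 := by
  rw [normSq2_sphTensor (hg.ne_zero hx) (hg.tang_ne_zero hx) (hg.rad_ne_zero hx)
    (hg.eq_sphTensor x hx) hT, div_eq_mul_inv A, ← inv_pow, inv_div]

lemma christoffel_eq (m i j : Fin 3) :
    christoffel g m i j x = connForm (connP σ ‖x‖) (connQ σ h ‖x‖) (connS σ h ‖x‖) x m i j := by
  have hr := hg.norm_pos hx
  have hσ := hg.radius_pos _ hx
  have hh := hg.speed_pos _ hx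
  have dσ := hasDerivAt_of_contDiffOn_Ioi hg.smooth_radius hx
  have dh := hasDerivAt_of_contDiffOn_Ioi hg.smooth_speed hx
  have dα : HasDerivAt (fun r => (σ r / r) ^ 2) _ ‖x‖ :=
    (dσ.fun_div (hasDerivAt_id' ‖x‖) hr.ne').fun_pow 2
  have dβ : HasDerivAt (fun r => (h r ^ 2 - (σ r / r) ^ 2) / r ^ 2) _ ‖x‖ :=
    ((dh.fun_pow 2).fun_sub dα).fun_div ((hasDerivAt_id' ‖x‖).fun_pow 2) (pow_pos hr 2).ne'
  have key := christoffel_of_tensor (hg.ne_zero hx) (g := g)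
    (fun i j => (eventually_lt_norm hx).mono fun y hy => by
      dsimp only
      rw [hg.eq_sphTensor y hy, sphTensor_apply]) dα dβ
    (fun i j => by rw [hg.ginv_eq hx, sphTensor_apply]) m i j
  rw [key]
  congr 1
  · simp only [connP, Nat.cast_ofNat, Nat.add_one_sub_one, pow_one]
    field_simp
  · simp only [connQ, Nat.cast_ofNat, Nat.add_one_sub_one, pow_one]
    field_simp
    ring
  · simp only [connS, connP, connQ, Nat.cast_ofNat, Nat.add_one_sub_one, pow_one]
    field_simp
    ring

lemma grad_radial (hF : DifferentiableAt ℝ F ‖x‖) (i : Fin 3) :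
    grad g (fun y => F ‖y‖) x i = deriv F ‖x‖ / (‖x‖ * h ‖x‖ ^ 2) * x i := by
  have hr := hg.norm_pos hx
  have h1 : grad g (fun y => F ‖y‖) x i = deriv F ‖x‖ / ‖x‖ *
      ∑ j, sphTensor ((σ ‖x‖ / ‖x‖) ^ 2)⁻¹ (h ‖x‖ ^ 2)⁻¹ x i j * x j := by
    rw [grad, Finset.mul_sum]
    refine Finset.sum_congr rfl fun j _ => ?_
    rw [hg.ginv_eq hx, pd_radial (hg.ne_zero hx) hF.hasDerivAt]
    ring
  rw [h1, sphTensor_sum_mul _ _ (hg.ne_zero hx)]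
  field_simp

lemma gradInner_radial {G : ℝ → ℝ} (hF : DifferentiableAt ℝ F ‖x‖)
    (hG : DifferentiableAt ℝ G ‖x‖) :
    gradInner g (fun y => F ‖y‖) (fun y => G ‖y‖) x
      = deriv F ‖x‖ * deriv G ‖x‖ / h ‖x‖ ^ 2 := by
  have hr := hg.norm_pos hx
  have h1 : gradInner g (fun y => F ‖y‖) (fun y => G ‖y‖) x
      = ∑ i, deriv F ‖x‖ / ‖x‖ * x i * grad g (fun y => G ‖y‖) x i := by
    rw [gradInner]
    refine Finset.sum_congr rfl fun i _ => ?_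
    rw [grad, Finset.mul_sum]
    refine Finset.sum_congr rfl fun j _ => ?_
    rw [pd_radial (hg.ne_zero hx) hF.hasDerivAt]
    ring
  have h2 : gradInner g (fun y => F ‖y‖) (fun y => G ‖y‖) x
      = deriv F ‖x‖ / ‖x‖ * (deriv G ‖x‖ / (‖x‖ * h ‖x‖ ^ 2)) * ∑ i, x i * x i := by
    rw [h1, Finset.mul_sum]
    refine Finset.sum_congr rfl fun i _ => ?_
    rw [hg.grad_radial hx hG]
    ring
  rw [h2, sum_mul_self_coords]
  field_simp

lemma gradNorm_radial (hF : DifferentiableAt ℝ F ‖x‖) (hF' : 0 ≤ deriv F ‖x‖) :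
    gradNorm g (fun y => F ‖y‖) x = deriv F ‖x‖ / h ‖x‖ := by
  rw [gradNorm, hg.gradInner_radial hx hF hF, ← sq, ← div_pow,
    Real.sqrt_sq (div_nonneg hF' (hg.speed_pos _ hx).le)]

lemma unitNormal_radial (hF : DifferentiableAt ℝ F ‖x‖) (hF' : 0 < deriv F ‖x‖) (i : Fin 3) :
    unitNormal g (fun y => F ‖y‖) x i = (‖x‖ * h ‖x‖)⁻¹ * x i := by
  have hr := hg.norm_pos hx
  have hh := hg.speed_pos _ hx
  rw [unitNormal, hg.gradNorm_radial hx hF hF'.le, hg.grad_radial hx hF]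
  field_simp

lemma normalPart_radial (hF : DifferentiableAt ℝ F ‖x‖) (hF' : 0 < deriv F ‖x‖)
    (hT : T x = sphTensor A C x) : normalPart g (fun y => F ‖y‖) T x = C / h ‖x‖ ^ 2 := by
  have hr := hg.norm_pos hx
  have hh := hg.speed_pos _ hx
  simp only [normalPart, ev, hg.unitNormal_radial hx hF hF', hT]
  rw [sphTensor_ev_self _ _ (hg.ne_zero hx)]
  field_simp

lemma hess_radial (hF : ContDiffOn ℝ ∞ F (Set.Ioi c)) :
    hess g (fun y => F ‖y‖) x = sphTensor (deriv F ‖x‖ * σ ‖x‖ * deriv σ ‖x‖ / (h ‖x‖ * ‖x‖) ^ 2)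
      (deriv (deriv F) ‖x‖ - deriv F ‖x‖ * deriv h ‖x‖ / h ‖x‖) x := by
  have hr := hg.norm_pos hx
  have hh := hg.speed_pos _ hx
  have hσ := hg.radius_pos _ hx
  have d2 := hasDerivAt_of_contDiffOn_Ioi (contDiffOn_deriv_Ioi hF) hx
  have d3 : HasDerivAt (fun r => deriv F r / r) _ ‖x‖ := d2.fun_div (hasDerivAt_id' ‖x‖) hr.ne'
  ext i j
  rw [hess_of_connForm (hg.ne_zero hx) (hg.christoffel_eq hx)
    ((eventually_lt_norm hx).mono fun y hy i =>
      pd_radial (hg.ne_zero hy) (hasDerivAt_of_contDiffOn_Ioi hF hy) i) d3, sphTensor_apply]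
  congr 2
  · simp only [connQ]
    field_simp
    ring
  · simp only [connS, connP, connQ]
    field_simp
    ring

lemma laplacian_radial (hF : ContDiffOn ℝ ∞ F (Set.Ioi c)) :
    laplacian g (fun y => F ‖y‖) x
      = 2 * (deriv F ‖x‖ * deriv σ ‖x‖ / (σ ‖x‖ * h ‖x‖ ^ 2))
        + (deriv (deriv F) ‖x‖ - deriv F ‖x‖ * deriv h ‖x‖ / h ‖x‖) / h ‖x‖ ^ 2 := by
  have hr := hg.norm_pos hx
  have hh := hg.speed_pos _ hx
  have hσ := hg.radius_pos _ hx
  rw [laplacian, hg.tr_eq hx (hg.hess_radial hx hF)]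
  congr 2
  field_simp

lemma diverg_radial {X : Pt 3 → Fin 3 → ℝ} {ξ : ℝ → ℝ} {ξ' : ℝ}
    (hX : ∀ᶠ y in 𝓝 x, ∀ i, X y i = ξ ‖y‖ * y i) (hξ : HasDerivAt ξ ξ' ‖x‖) :
    diverg g X x = ξ ‖x‖ + ‖x‖ * ξ'
      + ξ ‖x‖ * ‖x‖ * (2 * (deriv σ ‖x‖ / σ ‖x‖) + deriv h ‖x‖ / h ‖x‖) := by
  have hr := hg.norm_pos hx
  have hh := hg.speed_pos _ hx
  have hσ := hg.radius_pos _ hx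
  rw [diverg_of_connForm (hg.ne_zero hx) (hg.christoffel_eq hx) hX hξ]
  simp only [connS, connP]
  field_simp
  ring

/-- The mean curvature of the symmetric spheres. -/
lemma meanCurv_norm : meanCurv g (fun y => ‖y‖) x = 2 * deriv σ ‖x‖ / (σ ‖x‖ * h ‖x‖) := by
  have hr := hg.norm_pos hx
  have hh := hg.speed_pos _ hx
  have hσ := hg.radius_pos _ hx
  have dh := hasDerivAt_of_contDiffOn_Ioi hg.smooth_speed hx
  have dξ : HasDerivAt (fun r => (r * h r)⁻¹) _ ‖x‖ :=
    ((hasDerivAt_id' ‖x‖).fun_mul dh).fun_inv (mul_pos hr hh).ne'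
  rw [meanCurv, hg.diverg_radial hx ((eventually_lt_norm hx).mono fun y hy i =>
    hg.unitNormal_radial hy (F := fun r => r) differentiableAt_id (by simp) i) dξ]
  field_simp
  ring

/-- The scalar curvature `R = - 4 σ_ρρ / σ + 2 (1 - σ_ρ²) / σ²`, with the derivatives with respect
to arclength `dρ = h dr` written out. -/
lemma scalarCurv_eq : scalarCurv g x =
    -4 * (deriv (deriv σ) ‖x‖ / h ‖x‖ ^ 2 - deriv σ ‖x‖ * deriv h ‖x‖ / h ‖x‖ ^ 3) / σ ‖x‖
      + 2 * (1 - (deriv σ ‖x‖ / h ‖x‖) ^ 2) / σ ‖x‖ ^ 2 := by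
  have hr := hg.norm_pos hx
  have hh := hg.speed_pos _ hx
  have hσ := hg.radius_pos _ hx
  have dσ := hasDerivAt_of_contDiffOn_Ioi hg.smooth_radius hx
  have dσ' := hasDerivAt_of_contDiffOn_Ioi (contDiffOn_deriv_Ioi hg.smooth_radius) hx
  have dh := hasDerivAt_of_contDiffOn_Ioi hg.smooth_speed hx
  have dh' := hasDerivAt_of_contDiffOn_Ioi (contDiffOn_deriv_Ioi hg.smooth_speed) hx
  have did := hasDerivAt_id' ‖x‖
  have hr2 : ‖x‖ ^ 2 ≠ 0 := (pow_pos hr 2).ne'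
  have dP : HasDerivAt (connP σ) _ ‖x‖ :=
    ((dσ'.fun_div dσ hσ.ne').fun_sub (did.fun_inv hr.ne')).fun_div did hr.ne'
  have dQ : HasDerivAt (connQ σ h) _ ‖x‖ :=
    (((dσ.fun_mul dσ').fun_div (did.fun_mul (dh.fun_pow 2))
      (mul_pos hr (pow_pos hh 2)).ne').const_sub 1).fun_div (did.fun_pow 2) hr2
  have dS : HasDerivAt (connS σ h) _ ‖x‖ :=
    (((dh'.fun_div (dh.fun_mul did) (mul_pos hh hr).ne').fun_sub (dP.const_mul 2)).fun_sub
      dQ).fun_div (did.fun_pow 2) hr2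
  have key := ricci_of_connForm (hg.ne_zero hx) (g := g)
    (fun m i j => (eventually_lt_norm hx).mono fun y hy => hg.christoffel_eq hy m i j) dP dQ dS
  rw [scalarCurv, hg.tr_of_components hx (T := fun y => Matrix.of fun i j => ricci g i j y) key]
  simp only [connS, connP, connQ]
  field_simp
  ring

end basic

/-- A 2-tensor with tangential value `κ` and radial value `lam` in orthonormal frames of the warped
product metric. -/
def IsFrameTensor (c : ℝ) (σ h : ℝ → ℝ) (k : Tensor2 3) (κ lam : ℝ → ℝ) : Prop :=
  ∀ x : Pt 3, c < ‖x‖ →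
    k x = sphTensor (κ ‖x‖ * (σ ‖x‖ / ‖x‖) ^ 2) (lam ‖x‖ * h ‖x‖ ^ 2) x

section frame

variable {k : Tensor2 3} {κ lam : ℝ → ℝ} (hg : IsWarped c g σ h)
  (hk : IsFrameTensor c σ h k κ lam) (hx : c < ‖x‖)

include hg hk hx

lemma tr_frame : tr g k x = 2 * κ ‖x‖ + lam ‖x‖ := by
  have hr := hg.norm_pos hx
  have hh := hg.speed_pos _ hx
  have hσ := hg.radius_pos _ hx
  rw [hg.tr_eq hx (hk x hx)]
  field_simp

lemma normSq2_frame : normSq2 g k x = 2 * κ ‖x‖ ^ 2 + lam ‖x‖ ^ 2 := by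
  have hr := hg.norm_pos hx
  have hh := hg.speed_pos _ hx
  have hσ := hg.radius_pos _ hx
  rw [hg.normSq2_eq hx (hk x hx)]
  field_simp

lemma tangTrace_frame : tangTrace g (fun y => ‖y‖) k x = 2 * κ ‖x‖ := by
  have hh := hg.speed_pos _ hx
  rw [tangTrace, hg.tr_frame hk hx, hg.normalPart_radial hx (F := fun r => r) differentiableAt_id
    (by simp) (hk x hx)]
  field_simp
  ring

lemma energyDensity_eq : energyDensity g k x =
    -2 * (deriv (deriv σ) ‖x‖ / h ‖x‖ ^ 2 - deriv σ ‖x‖ * deriv h ‖x‖ / h ‖x‖ ^ 3) / σ ‖x‖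
      + (1 - (deriv σ ‖x‖ / h ‖x‖) ^ 2) / σ ‖x‖ ^ 2
      + 2 * lam ‖x‖ * κ ‖x‖ + κ ‖x‖ ^ 2 := by
  rw [energyDensity, hg.scalarCurv_eq hx, hg.tr_frame hk hx, hg.normSq2_frame hk hx]
  ring

lemma momentumDensity_eq (hκ : ContDiffOn ℝ ∞ κ (Set.Ioi c))
    (hlam : ContDiffOn ℝ ∞ lam (Set.Ioi c)) (m : Fin 3) : momentumDensity g k x m =
      (-2 * deriv κ ‖x‖ + 2 * deriv σ ‖x‖ * (lam ‖x‖ - κ ‖x‖) / σ ‖x‖) / ‖x‖ * x m := by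
  have hr := hg.norm_pos hx
  have hσ := hg.radius_pos _ hx
  have hh := hg.speed_pos _ hx
  have dσ := hasDerivAt_of_contDiffOn_Ioi hg.smooth_radius hx
  have dh := hasDerivAt_of_contDiffOn_Ioi hg.smooth_speed hx
  have dκ := hasDerivAt_of_contDiffOn_Ioi hκ hx
  have dlam := hasDerivAt_of_contDiffOn_Ioi hlam hx
  have did := hasDerivAt_id' ‖x‖
  have dA : HasDerivAt (fun r => -(lam r + κ r) * (σ r / r) ^ 2) _ ‖x‖ :=
    (dlam.fun_add dκ).fun_neg.fun_mul ((dσ.fun_div did hr.ne').fun_pow 2)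
  have dB : HasDerivAt (fun r => (-(2 * κ r) * h r ^ 2 - -(lam r + κ r) * (σ r / r) ^ 2) / r ^ 2)
      _ ‖x‖ :=
    ((((dκ.const_mul 2).fun_neg.fun_mul (dh.fun_pow 2)).fun_sub dA).fun_div (did.fun_pow 2)
      (pow_pos hr 2).ne')
  rw [momentumDensity, diverg2_of_connForm (hg.ne_zero hx) (hg.christoffel_eq hx)
    (fun i j => by rw [hg.ginv_eq hx, sphTensor_apply])
    (fun i j => (eventually_lt_norm hx).mono fun y hy => by
      have hy0 := hg.norm_pos hy
      dsimp only
      rw [Matrix.sub_apply, Matrix.smul_apply, hk y hy, hg.eq_sphTensor y hy, hg.tr_frame hk hy,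
        sphTensor_apply, sphTensor_apply, smul_eq_mul]
      field_simp
      ring) dA dB]
  congr 1
  simp only [connS, connP, connQ]
  field_simp
  ring

lemma momentumNorm_eq (hκ : ContDiffOn ℝ ∞ κ (Set.Ioi c))
    (hlam : ContDiffOn ℝ ∞ lam (Set.Ioi c)) : momentumNorm g k x =
      |-2 * deriv κ ‖x‖ + 2 * deriv σ ‖x‖ * (lam ‖x‖ - κ ‖x‖) / σ ‖x‖| / h ‖x‖ := by
  have hr := hg.norm_pos hx
  have hh := hg.speed_pos _ hx
  simp only [momentumNorm, hg.momentumDensity_eq hk hx hκ hlam, hg.ginv_eq hx]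
  rw [sphTensor_ev_self _ _ (hg.ne_zero hx)]
  generalize -2 * deriv κ ‖x‖ + 2 * deriv σ ‖x‖ * (lam ‖x‖ - κ ‖x‖) / σ ‖x‖ = B
  rw [show (h ‖x‖ ^ 2)⁻¹ * (B / ‖x‖) ^ 2 * ‖x‖ ^ 2 = (B / h ‖x‖) ^ 2 by field_simp,
    Real.sqrt_sq_eq_abs, abs_div, abs_of_pos hh]

end frame

end IsWarped

/-! ### Area and Gaussian curvature of the symmetric spheres -/

section pd

variable {n : ℕ} {y : Pt n}

lemma pd_comp_coord {F : ℝ → ℝ} {F' : ℝ} {j : Fin n} (hF : HasDerivAt F F' (y j)) (i : Fin n) :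
    pd i (fun z => F (z j)) y = F' * (if i = j then 1 else 0) := by
  have h : HasFDerivAt (fun z : Pt n => z j) (EuclideanSpace.proj (𝕜 := ℝ) j) y :=
    (EuclideanSpace.proj (𝕜 := ℝ) j).hasFDerivAt
  have h2 : HasFDerivAt (fun z : Pt n => F (z j)) _ y := hF.comp_hasFDerivAt y h
  rw [pd, h2.fderiv]
  simp [eq_comm]

lemma pd_comp_add (f : Pt n → ℝ) (p : Pt n) (i : Fin n) :
    pd i (fun z => f (z + p)) y = pd i f (y + p) := by
  rw [pd, pd, fderiv_comp_add_right]

end pd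

/-- The tangent vectors `∂φ/∂θ`, `∂φ/∂ϕ` of spherical coordinates. -/
def sphereTangent (r : ℝ) (y : Pt 2) (a : Fin 2) (i : Fin 3) : ℝ :=
  !![r * (Real.cos (y 0) * Real.cos (y 1)), r * (Real.cos (y 0) * Real.sin (y 1)),
      -(r * Real.sin (y 0));
    -(r * (Real.sin (y 0) * Real.sin (y 1))), r * (Real.sin (y 0) * Real.cos (y 1)), 0] a i

lemma differentiable_sphereParam (r : ℝ) (i : Fin 3) :
    Differentiable ℝ (fun z => sphereParam r z i) := by
  fin_cases i <;> simp [sphereParam] <;> fun_prop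

lemma contDiff_sphereParam (r : ℝ) : ContDiff ℝ ∞ (sphereParam r) := by
  rw [contDiff_euclidean]
  intro i
  fin_cases i <;> simp [sphereParam] <;> fun_prop

lemma pd_sphereParam (r : ℝ) (y : Pt 2) (a : Fin 2) (i : Fin 3) :
    pd a (fun z => sphereParam r z i) y = sphereTangent r y a i := by
  have hs : ∀ (j : Fin 2) (z : Pt 2), DifferentiableAt ℝ (fun z : Pt 2 => Real.sin (z j)) z :=
    fun j z => by fun_prop
  have hc : ∀ (j : Fin 2) (z : Pt 2), DifferentiableAt ℝ (fun z : Pt 2 => Real.cos (z j)) z :=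
    fun j z => by fun_prop
  have ps : ∀ j : Fin 2, pd a (fun z => Real.sin (z j)) y = _ :=
    fun j => pd_comp_coord (Real.hasDerivAt_sin (y j)) a
  have pc : ∀ j : Fin 2, pd a (fun z => Real.cos (z j)) y = _ :=
    fun j => pd_comp_coord (Real.hasDerivAt_cos (y j)) a
  have h0 : pd a (fun z => r * (Real.sin (z 0) * Real.cos (z 1))) y =
      r * (Real.sin (y 0) * pd a (fun z => Real.cos (z 1)) y
        + pd a (fun z => Real.sin (z 0)) y * Real.cos (y 1)) := by
    rw [pd_mul (differentiableAt_const r) ((hs 0 y).fun_mul (hc 1 y)), pd_const,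
      pd_mul (hs 0 y) (hc 1 y), zero_mul, add_zero]
  have h1 : pd a (fun z => r * (Real.sin (z 0) * Real.sin (z 1))) y =
      r * (Real.sin (y 0) * pd a (fun z => Real.sin (z 1)) y
        + pd a (fun z => Real.sin (z 0)) y * Real.sin (y 1)) := by
    rw [pd_mul (differentiableAt_const r) ((hs 0 y).fun_mul (hs 1 y)), pd_const,
      pd_mul (hs 0 y) (hs 1 y), zero_mul, add_zero]
  have h2 : pd a (fun z => r * Real.cos (z 0)) y = r * pd a (fun z => Real.cos (z 0)) y := by
    rw [pd_mul (differentiableAt_const r) (hc 0 y), pd_const, zero_mul, add_zero]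
  rw [ps, pc] at h0
  rw [ps, ps] at h1
  rw [pc] at h2
  fin_cases i
  · refine h0.trans ?_
    fin_cases a <;> simp [sphereTangent]
  · refine h1.trans ?_
    fin_cases a <;> simp [sphereTangent]
  · refine h2.trans ?_
    fin_cases a <;> simp [sphereTangent]

lemma norm_sphereParam {r : ℝ} (hr : 0 ≤ r) (y : Pt 2) : ‖sphereParam r y‖ = r := by
  rw [← sq_eq_sq₀ (norm_nonneg _) hr, norm_sq_coords]
  simp [sphereParam]
  linear_combination r ^ 2 * (Real.sin (y 0) ^ 2 * Real.sin_sq_add_cos_sq (y 1)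
    + Real.sin_sq_add_cos_sq (y 0))

lemma sum_sphereParam_mul_tangent (r : ℝ) (y : Pt 2) (a : Fin 2) :
    ∑ i, sphereParam r y i * sphereTangent r y a i = 0 := by
  have h := Real.sin_sq_add_cos_sq (y 1)
  fin_cases a <;> simp [Fin.sum_univ_three, sphereParam, sphereTangent]
  · linear_combination r ^ 2 * Real.sin (y 0) * Real.cos (y 0) * h
  · ring

/-- The round metric `r² (dθ² + sin² θ dϕ²)`. -/
lemma sum_tangent_mul_tangent (r : ℝ) (y : Pt 2) (a b : Fin 2) :
    ∑ i, sphereTangent r y a i * sphereTangent r y b i =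
      (!![r ^ 2, 0; 0, r ^ 2 * Real.sin (y 0) ^ 2] : Matrix (Fin 2) (Fin 2) ℝ) a b := by
  have h := Real.sin_sq_add_cos_sq (y 1)
  have h' := Real.sin_sq_add_cos_sq (y 0)
  fin_cases a <;> fin_cases b <;> simp [Fin.sum_univ_three, sphereTangent]
  · linear_combination r ^ 2 * Real.cos (y 0) ^ 2 * h + r ^ 2 * h'
  · ring
  · ring
  · linear_combination r ^ 2 * Real.sin (y 0) ^ 2 * h

/-- The pullback of a spherically symmetric tensor under a map tangent to a symmetric sphere. -/
lemma pullback_of_tangent {g : Tensor2 3} {m : ℕ} {φ : Pt m → Pt 3} {y : Pt m} {A C : ℝ}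
    (hg : g (φ y) = sphTensor A C (φ y))
    (ht : ∀ a, ∑ i, φ y i * pd a (fun z => φ z i) y = 0) (a b : Fin m) :
    pullback g φ y a b = A * ∑ i, pd a (fun z => φ z i) y * pd b (fun z => φ z i) y := by
  have h : pullback g φ y a b = A * (∑ i, pd a (fun z => φ z i) y * pd b (fun z => φ z i) y)
      + (C - A) / ‖φ y‖ ^ 2 * (∑ i, φ y i * pd a (fun z => φ z i) y)
        * (∑ i, φ y i * pd b (fun z => φ z i) y) := by
    simp only [pullback, Matrix.of_apply, hg, sphTensor_apply, Fin.sum_univ_three]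
    simp
    ring
  rw [h, ht a]
  ring

namespace IsWarped

variable {c : ℝ} {g : Tensor2 3} {σ h : ℝ → ℝ} {r : ℝ}

lemma pullback_sphereParam (hg : IsWarped c g σ h) (hr : c < r) (y : Pt 2) :
    pullback g (sphereParam r) y = !![σ r ^ 2, 0; 0, σ r ^ 2 * Real.sin (y 0) ^ 2] := by
  have hr0 : 0 < r := hg.nonneg.trans_lt hr
  have hn := norm_sphereParam hr0.le y
  ext a b
  rw [pullback_of_tangent (hg.eq_sphTensor _ (by rwa [hn])) (fun a => by
    simp_rw [pd_sphereParam]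
    exact sum_sphereParam_mul_tangent r y a)]
  simp_rw [pd_sphereParam]
  rw [sum_tangent_mul_tangent, hn]
  fin_cases a <;> fin_cases b <;> simp <;> field_simp

lemma sphereIntegral_eq (hg : IsWarped c g σ h) (hr : c < r) (F : Pt 3 → ℝ) :
    sphereIntegral g r F = ∫ θ in (0 : ℝ)..Real.pi,
      (∫ ϕ in (0 : ℝ)..(2 * Real.pi), F (sphereParam r !₂[θ, ϕ])) * (σ r ^ 2 * Real.sin θ) := by
  refine intervalIntegral.integral_congr fun θ hθ => ?_
  rw [Set.uIcc_of_le Real.pi_pos.le] at hθ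
  have hs : 0 ≤ Real.sin θ := Real.sin_nonneg_of_mem_Icc hθ
  rw [← intervalIntegral.integral_mul_const]
  refine intervalIntegral.integral_congr fun ϕ _ => ?_
  rw [hg.pullback_sphereParam hr, Matrix.det_fin_two]
  congr 1
  rw [show (σ r ^ 2 * Real.sin θ) = √((σ r ^ 2 * Real.sin θ) ^ 2) by
    rw [Real.sqrt_sq (by positivity)]]
  congr 1
  simp
  ring

lemma sphereIntegral_of_const (hg : IsWarped c g σ h) (hr : c < r) {F : Pt 3 → ℝ} {K : ℝ}
    (hF : ∀ x : Pt 3, ‖x‖ = r → F x = K) :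
    sphereIntegral g r F = 4 * Real.pi * σ r ^ 2 * K := by
  have hr0 : 0 < r := hg.nonneg.trans_lt hr
  rw [hg.sphereIntegral_eq hr]
  simp_rw [hF _ (norm_sphereParam hr0.le _)]
  simp only [intervalIntegral.integral_const, intervalIntegral.integral_const_mul, integral_sin]
  simp
  ring

end IsWarped

lemma isWarped_flat : IsWarped 0 SphericalIDS.flat (fun r => r) (fun _ => 1) where
  nonneg := le_rfl
  smooth_radius := contDiffOn_id
  smooth_speed := contDiffOn_const
  radius_pos := fun _ hr => hr
  speed_pos := fun _ _ => one_pos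
  eq_sphTensor := fun x hx => by
    rw [div_self hx.ne', one_pow, sphTensor_one, SphericalIDS.flat]

/-- Linear functions have mean zero on the Euclidean spheres. -/
lemma sphereIntegral_flat_linear {r K : ℝ} (hr : 0 < r) {F : Pt 3 → ℝ} {i : Fin 3}
    (hF : ∀ x : Pt 3, ‖x‖ = r → F x = K * x i) : sphereIntegral SphericalIDS.flat r F = 0 := by
  rw [isWarped_flat.sphereIntegral_eq hr]
  simp_rw [hF _ (norm_sphereParam hr.le _)]
  fin_cases i <;> simp [sphereParam]
  have h : ∀ θ : ℝ, K * (r * (2 * Real.pi * Real.cos θ)) * (r ^ 2 * Real.sin θ)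
      = 2 * Real.pi * K * r ^ 3 * (Real.sin θ * Real.cos θ) := fun θ => by ring
  simp_rw [h]
  simp [integral_sin_mul_cos₁]

/-- The round metric `A (dy₀² + cos² y₀ dy₁²)` has Gaussian curvature `1 / A` at the origin. -/
lemma scalarCurv_round {A : ℝ} (hA : 0 < A) {G : Tensor2 2}
    (hG : ∀ y, G y = !![A, 0; 0, A * Real.cos (y 0) ^ 2]) : scalarCurv G 0 = 2 / A := by
  have hinv : ∀ y : Pt 2, Real.cos (y 0) ≠ 0 → ∀ i j,
      ginv G y i j = !![A⁻¹, 0; 0, (A * Real.cos (y 0) ^ 2)⁻¹] i j := fun y hy i j => by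
    rw [ginv, hG, Matrix.inv_eq_right_inv (B := !![A⁻¹, 0; 0, (A * Real.cos (y 0) ^ 2)⁻¹])]
    ext i j
    fin_cases i <;> fin_cases j <;> simp [Matrix.mul_apply, Fin.sum_univ_two] <;> field_simp
  have hpd : ∀ (y : Pt 2) (l i j : Fin 2), pd l (fun z => G z i j) y =
      if l = 0 ∧ i = 1 ∧ j = 1 then -(2 * A * Real.cos (y 0) * Real.sin (y 0)) else 0 :=
    fun y l i j => by
    have hd : HasDerivAt (fun t => A * Real.cos t ^ 2) _ (y 0) :=
      ((Real.hasDerivAt_cos (y 0)).fun_pow 2).const_mul A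
    have h11 := pd_comp_coord hd l
    simp_rw [hG]
    fin_cases i <;> fin_cases j <;> simp [pd_const]
    refine h11.trans ?_
    fin_cases l <;> simp
    ring
  have hnear : ∀ᶠ y : Pt 2 in 𝓝 0, Real.cos (y 0) ≠ 0 := by
    have hcont : Continuous fun y : Pt 2 => Real.cos (y 0) := by fun_prop
    exact hcont.continuousAt.eventually_ne (by simp)
  have hΓ : ∀ y : Pt 2, Real.cos (y 0) ≠ 0 → ∀ m i j, christoffel G m i j y =
      if m = 0 ∧ i = 1 ∧ j = 1 then Real.cos (y 0) * Real.sin (y 0)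
      else if m = 1 ∧ i ≠ j then -(Real.sin (y 0) / Real.cos (y 0)) else 0 := fun y hy m i j => by
    simp only [christoffel, hpd, hinv y hy]
    fin_cases m <;> fin_cases i <;> fin_cases j <;> simp <;> field_simp
  have hd1 : ∀ l : Fin 2, pd l (fun y : Pt 2 => Real.cos (y 0) * Real.sin (y 0)) 0 =
      if l = 0 then 1 else 0 := fun l => by
    have hd : HasDerivAt (fun t => Real.cos t * Real.sin t) _ ((0 : Pt 2) 0) :=
      (Real.hasDerivAt_cos _).fun_mul (Real.hasDerivAt_sin _)
    refine (pd_comp_coord hd l).trans ?_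
    simp
  have hd2 : ∀ l : Fin 2, pd l (fun y : Pt 2 => -(Real.sin (y 0) / Real.cos (y 0))) 0 =
      if l = 0 then -1 else 0 := fun l => by
    have hd : HasDerivAt (fun t => -(Real.sin t / Real.cos t)) _ ((0 : Pt 2) 0) :=
      ((Real.hasDerivAt_sin _).fun_div (Real.hasDerivAt_cos _) (by simp)).fun_neg
    refine (pd_comp_coord hd l).trans ?_
    simp
  have hpΓ : ∀ l m i j : Fin 2, pd l (christoffel G m i j) 0 =
      if l = 0 then (if m = 0 ∧ i = 1 ∧ j = 1 then 1 else if m = 1 ∧ i ≠ j then -1 else 0)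
      else 0 := fun l m i j => by
    rw [pd_congr (hnear.mono fun y hy => hΓ y hy m i j)]
    by_cases h1 : m = 0 ∧ i = 1 ∧ j = 1
    · simp only [h1, and_self, if_true]
      exact hd1 l
    · by_cases h2 : m = 1 ∧ i ≠ j
      · simp only [h2, and_self, if_true, ne_eq, not_false_eq_true]
        exact hd2 l
      · simp only [h1, h2, if_false, pd_const, ite_self]
  have hΓ0 := hΓ 0 (by simp)
  simp only [scalarCurv, tr, hinv 0 (by simp), Matrix.of_apply, ricci, hpΓ, hΓ0, Fin.sum_univ_two]
  simp
  ring

/-- The symmetric sphere of area radius `σ` has Gaussian curvature `1 / σ²`: it is parametrized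
near each of its points by a rotation of spherical coordinates based at the equator. -/
lemma IsWarped.hasGaussCurvAt {c : ℝ} {g : Tensor2 3} {σ h : ℝ → ℝ} (hg : IsWarped c g σ h)
    {x : Pt 3} (hx : c < ‖x‖) (F : ℝ → ℝ) :
    HasGaussCurvAt g (fun y => F ‖y‖) x (1 / σ ‖x‖ ^ 2) := by
  have hr := hg.norm_pos hx
  obtain ⟨R, hR, hRx⟩ := exists_rotation x
  set r := ‖x‖ with hrdef
  have hRR : R.transpose * R = 1 := by
    have := (Matrix.mem_orthogonalGroup_iff' (Fin 3) ℝ).1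
      ((Matrix.mem_specialOrthogonalGroup_iff (A := R)).1 hR).1
    simpa [Matrix.star_eq_conjTranspose] using this
  have hcol : ∀ p q : Fin 3 → ℝ, ∑ i, (∑ l, R i l * p l) * (∑ m, R i m * q m) = ∑ l, p l * q l := by
    intro p q
    have h := fun l m => congrFun (congrFun hRR l) m
    simp only [Matrix.mul_apply, Fin.sum_univ_three, Matrix.transpose_apply, Matrix.one_apply] at h
    have h00 := h 0 0
    have h01 := h 0 1
    have h02 := h 0 2
    have h11 := h 1 1
    have h12 := h 1 2
    have h22 := h 2 2
    simp at h00 h01 h02 h11 h12 h22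
    simp only [Fin.sum_univ_three]
    linear_combination p 0 * q 0 * h00 + p 1 * q 1 * h11 + p 2 * q 2 * h22
      + (p 0 * q 1 + p 1 * q 0) * h01 + (p 0 * q 2 + p 2 * q 0) * h02
      + (p 1 * q 2 + p 2 * q 1) * h12
  -- Spherical coordinates degenerate at the poles, so their origin is moved to the equator, where
  -- `sphereParam` takes the value `axisPt r`.
  set p : Pt 2 := !₂[Real.pi / 2, 0] with hp
  set φ : Pt 2 → Pt 3 := fun z => WithLp.toLp 2 (R.mulVec (sphereParam r (z + p)).ofLp) with hφ
  have hφi : ∀ z i, φ z i = ∑ l, R i l * sphereParam r (z + p) l := fun z i => rfl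
  have hsin : ∀ y : Pt 2, Real.sin ((y + p) 0) = Real.cos (y 0) := fun y => by
    simp [hp, Real.sin_add_pi_div_two]
  have hpd : ∀ y a i, pd a (fun z => φ z i) y
      = ∑ l, R i l * sphereTangent r (y + p) a l := fun y a i => by
    have hd : ∀ l, DifferentiableAt ℝ (fun z => sphereParam r (z + p) l) y := fun l =>
      (differentiable_sphereParam r l).differentiableAt.comp y
        (differentiableAt_id.add_const p)
    have hl : ∀ l, pd a (fun z => sphereParam r (z + p) l * R i l) y
        = sphereTangent r (y + p) a l * R i l := fun l => by
      rw [pd_mul_const (hd l), pd_comp_add (fun z => sphereParam r z l), pd_sphereParam]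
    have hsum : (fun z => φ z i) = fun z => sphereParam r (z + p) 0 * R i 0
        + sphereParam r (z + p) 1 * R i 1 + sphereParam r (z + p) 2 * R i 2 := by
      ext z
      rw [hφi, Fin.sum_univ_three]
      ring
    rw [hsum, pd_add (((hd 0).mul_const _).fun_add ((hd 1).mul_const _)) ((hd 2).mul_const _),
      pd_add ((hd 0).mul_const _) ((hd 1).mul_const _), hl, hl, hl, Fin.sum_univ_three]
    ring
  have hnorm : ∀ z, ‖φ z‖ = r := fun z => by
    rw [← sq_eq_sq₀ (norm_nonneg _) hr.le, ← sum_mul_self_coords]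
    simp_rw [hφi]
    rw [hcol, sum_mul_self_coords, norm_sphereParam hr.le]
  have hpb : ∀ y, pullback g φ y = !![σ r ^ 2, 0; 0, σ r ^ 2 * Real.cos (y 0) ^ 2] := fun y => by
    ext a b
    rw [pullback_of_tangent (hg.eq_sphTensor _ (by rwa [hnorm])) (fun a => by
      simp_rw [hpd, hφi]
      rw [hcol]
      exact sum_sphereParam_mul_tangent r _ a)]
    simp_rw [hpd]
    rw [hcol, sum_tangent_mul_tangent, hnorm, hsin]
    fin_cases a <;> fin_cases b <;> simp <;> field_simp
  have hsm : ContDiff ℝ ∞ φ := by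
    rw [contDiff_euclidean]
    intro i
    have h1 := (contDiff_euclidean.1 ((contDiff_sphereParam r).comp
      (contDiff_id.add (contDiff_const (c := p)))))
    simp_rw [hφi]
    exact ContDiff.sum fun l _ => contDiff_const.mul (h1 l)
  refine ⟨φ, {y | Real.cos (y 0) ≠ 0}, ?_, by simp, hsm.contDiffOn, ?_, ?_, ?_, ?_⟩
  · have hcont : Continuous fun y : Pt 2 => Real.cos (y 0) := by fun_prop
    exact isOpen_ne_fun hcont continuous_const
  · intro y hy
    -- The first fundamental form is nondegenerate where `cos y₀ ≠ 0`.
    have hinj : ∀ w, fderiv ℝ φ y w = 0 → w = 0 := by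
      intro w hw
      have hwi : ∀ i, ∑ a, w a * pd a (fun z => φ z i) y = 0 := fun i => by
        have hφd : DifferentiableAt ℝ φ y := hsm.differentiable (by simp) y
        have h1 : ∀ v, fderiv ℝ (fun z => φ z i) y v = (fderiv ℝ φ y v) i := fun v => by
          have h2 : HasFDerivAt (fun z => φ z i)
              ((EuclideanSpace.proj (𝕜 := ℝ) i).comp (fderiv ℝ φ y)) y :=
            (EuclideanSpace.proj (𝕜 := ℝ) i).hasFDerivAt.comp y hφd.hasFDerivAt
          rw [h2.fderiv]
          rfl
        have h3 : w = w 0 • EuclideanSpace.single 0 (1 : ℝ)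
            + w 1 • EuclideanSpace.single 1 (1 : ℝ) := by
          ext j
          fin_cases j <;> simp
        have h4 : fderiv ℝ (fun z => φ z i) y w = 0 := by rw [h1, hw]; rfl
        rw [h3, map_add, map_smul, map_smul] at h4
        simpa [Fin.sum_univ_two, pd] using h4
      have hb : ∀ b : Fin 2, ∑ a, w a *
          ∑ i, pd a (fun z => φ z i) y * pd b (fun z => φ z i) y = 0 := fun b => by
        calc ∑ a, w a * ∑ i, pd a (fun z => φ z i) y * pd b (fun z => φ z i) y
            = ∑ i, (∑ a, w a * pd a (fun z => φ z i) y) * pd b (fun z => φ z i) y := by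
              simp only [Fin.sum_univ_two, Fin.sum_univ_three]
              ring
          _ = 0 := by simp [hwi]
      simp_rw [hpd, hcol, sum_tangent_mul_tangent, hsin] at hb
      have hb0 := hb 0
      have hb1 := hb 1
      simp [Fin.sum_univ_two, hr.ne'] at hb0 hb1
      ext j
      fin_cases j
      · exact hb0
      · exact hb1.resolve_right hy
    exact (injective_iff_map_eq_zero _).2 hinj
  · have h0 : sphereParam r (0 + p) = axisPt r := by
      ext i
      fin_cases i <;> simp [sphereParam, axisPt, hp]
    rw [hφ]
    dsimp only
    rw [h0, hRx]
  · intro y _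
    dsimp only
    rw [hnorm, hrdef]
  · rw [scalarCurv_round (pow_pos (hg.radius_pos _ hx) 2) hpb]
    ring

/-! ### Volume integrals of radial functions over shells -/

lemma measurableSet_shell (r₁ r₂ : ℝ) : MeasurableSet (shell r₁ r₂) :=
  ((isOpen_lt continuous_const continuous_norm).inter
    (isOpen_lt continuous_norm continuous_const)).measurableSet

lemma setIntegral_shell_radial {r₁ r₂ : ℝ} (h0 : 0 ≤ r₁) (h12 : r₁ ≤ r₂) {F : Pt 3 → ℝ}
    {Φ : ℝ → ℝ} (hF : ∀ x ∈ shell r₁ r₂, F x = Φ ‖x‖) :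
    ∫ x in shell r₁ r₂, F x = 4 * Real.pi * ∫ r in r₁..r₂, r ^ 2 * Φ r := by
  have h1 : ∫ x in shell r₁ r₂, F x = ∫ x : Pt 3, (Set.Ioo r₁ r₂).indicator Φ ‖x‖ := by
    rw [← integral_indicator (measurableSet_shell r₁ r₂)]
    congr 1
    ext x
    by_cases hx : x ∈ shell r₁ r₂
    · rw [Set.indicator_of_mem hx, Set.indicator_of_mem (show ‖x‖ ∈ Set.Ioo r₁ r₂ from hx), hF x hx]
    · rw [Set.indicator_of_notMem hx,
        Set.indicator_of_notMem (show ‖x‖ ∉ Set.Ioo r₁ r₂ from hx)]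
  have h2 : ∫ y in Set.Ioi (0 : ℝ), y ^ 2 • (Set.Ioo r₁ r₂).indicator Φ y
      = ∫ r in r₁..r₂, r ^ 2 * Φ r := by
    have h3 : ∀ y : ℝ, y ^ 2 • (Set.Ioo r₁ r₂).indicator Φ y
        = (Set.Ioo r₁ r₂).indicator (fun r => r ^ 2 * Φ r) y := fun y => by
      by_cases hy : y ∈ Set.Ioo r₁ r₂ <;> simp [hy]
    simp_rw [h3]
    have hsub : Set.Ioo r₁ r₂ ⊆ Set.Ioi 0 := fun y hy => h0.trans_lt hy.1
    rw [setIntegral_indicator measurableSet_Ioo, Set.inter_eq_right.2 hsub, intervalIntegral.integral_of_le h12,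
      integral_Ioc_eq_integral_Ioo]
  have hball : (volume : Measure (Pt 3)).real (Metric.ball 0 1) = Real.pi * 4 / 3 := by
    rw [measureReal_def, EuclideanSpace.volume_ball_fin_three]
    simp
    positivity
  rw [h1, integral_fun_norm_addHaar]
  simp only [finrank_euclideanSpace, Fintype.card_fin, Nat.add_one_sub_one, hball,
    nsmul_eq_mul, smul_eq_mul] at h2 ⊢
  rw [h2]
  push_cast
  ring

lemma integrableOn_shell_radial {r₁ r₂ : ℝ} {F : Pt 3 → ℝ} {Φ : ℝ → ℝ}
    (hΦ : ContinuousOn Φ (Set.Icc r₁ r₂)) (hF : ∀ x ∈ shell r₁ r₂, F x = Φ ‖x‖) :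
    IntegrableOn F (shell r₁ r₂) := by
  have hcomp : IsCompact {x : Pt 3 | r₁ ≤ ‖x‖ ∧ ‖x‖ ≤ r₂} :=
    (isCompact_closedBall (0 : Pt 3) r₂).of_isClosed_subset
      ((isClosed_le continuous_const continuous_norm).inter
        (isClosed_le continuous_norm continuous_const))
      fun x hx => mem_closedBall_zero_iff.2 hx.2
  have h1 : IntegrableOn (fun x : Pt 3 => Φ ‖x‖) (shell r₁ r₂) :=
    ((hΦ.comp continuous_norm.continuousOn fun x hx => hx).integrableOn_compact hcomp).mono_set
      fun x hx => ⟨hx.1.le, hx.2.le⟩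
  exact h1.congr_fun (fun x hx => (hF x hx).symm) (measurableSet_shell r₁ r₂)

namespace IsWarped

variable {c : ℝ} {g : Tensor2 3} {σ h : ℝ → ℝ}

lemma volDensity_eq (hg : IsWarped c g σ h) {x : Pt 3} (hx : c < ‖x‖) :
    volDensity g x = (σ ‖x‖ / ‖x‖) ^ 2 * h ‖x‖ := by
  have hh := hg.speed_pos _ hx
  rw [volDensity, hg.eq_sphTensor x hx, sphTensor_det _ _ (hg.ne_zero hx), ← mul_pow,
    Real.sqrt_sq (by positivity)]

/-- A density which is a derivative `dΨ/dr`, relative to `σ² h`, integrates to `4π` times the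
increment of `Ψ`. -/
lemma shellIntegral_of_deriv (hg : IsWarped c g σ h) {Ψ : ℝ → ℝ}
    (hΨ : ContDiffOn ℝ ∞ Ψ (Set.Ioi c)) {r₁ r₂ : ℝ} (h1 : c < r₁) (h12 : r₁ ≤ r₂) {F : Pt 3 → ℝ}
    (hF : ∀ x ∈ shell r₁ r₂, F x = deriv Ψ ‖x‖ / (σ ‖x‖ ^ 2 * h ‖x‖)) :
    IntegrableOn (fun x => F x * volDensity g x) (shell r₁ r₂) ∧
      shellIntegral g r₁ r₂ F = 4 * Real.pi * (Ψ r₂ - Ψ r₁) := by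
  have hsub : Set.Icc r₁ r₂ ⊆ Set.Ioi c := fun r hr => h1.trans_le hr.1
  have hr0 : ∀ r ∈ Set.Icc r₁ r₂, r ≠ 0 := fun r hr => (hg.nonneg.trans_lt (hsub hr)).ne'
  have hcont : ContinuousOn (deriv Ψ) (Set.Icc r₁ r₂) :=
    (contDiffOn_deriv_Ioi hΨ).continuousOn.mono hsub
  have hF' : ∀ x ∈ shell r₁ r₂, F x * volDensity g x = (fun r => deriv Ψ r / r ^ 2) ‖x‖ := by
    intro x hx
    have hxc := h1.trans hx.1
    have hr := hg.norm_pos hxc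
    have hh := hg.speed_pos _ hxc
    have hσ := hg.radius_pos _ hxc
    rw [hF x hx, hg.volDensity_eq hxc]
    field_simp
  refine ⟨integrableOn_shell_radial (hcont.div (by fun_prop)
    fun r hr => pow_ne_zero 2 (hr0 r hr)) hF', ?_⟩
  rw [shellIntegral, setIntegral_shell_radial (Φ := fun r => deriv Ψ r / r ^ 2)
    (hg.nonneg.trans h1.le) h12 hF']
  congr 1
  have hu : Set.uIcc r₁ r₂ = Set.Icc r₁ r₂ := Set.uIcc_of_le h12
  rw [intervalIntegral.integral_congr (g := deriv Ψ)]
  · refine intervalIntegral.integral_eq_sub_of_hasDerivAt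
      (fun r hr => hasDerivAt_of_contDiffOn_Ioi hΨ (hsub (hu ▸ hr))) ?_
    exact ContinuousOn.intervalIntegrable (hu ▸ hcont)
  · intro r hr
    have := hr0 r (hu ▸ hr)
    dsimp only
    field_simp

end IsWarped

/-! ### The system of equations in warped coordinates -/

/-- Radial profiles `U`, `V` of a solution of the system: `U + V = σ / 2` and
`V' - U' = κ σ h / 2` outside `|x| = c`, with `U` and `V` increasing outside `|x| = r₀`. -/
structure IsProfile (c r₀ : ℝ) (σ h κ U V : ℝ → ℝ) : Prop where
  le : c < r₀
  smooth_fst : ContDiffOn ℝ ∞ U (Set.Ioi c)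
  smooth_snd : ContDiffOn ℝ ∞ V (Set.Ioi c)
  add_eq : ∀ r, U r + V r = σ r / 2
  deriv_fst : ∀ r, c < r → deriv U r = (deriv σ r - κ r * σ r * h r) / 4
  deriv_snd : ∀ r, c < r → deriv V r = (deriv σ r + κ r * σ r * h r) / 4
  pos_fst : ∀ r, r₀ < r → 0 < deriv U r
  pos_snd : ∀ r, r₀ < r → 0 < deriv V r

/-- The Hawking energy `(σ / 2) (1 - σ_ρ² + σ² κ²)` as a function of the coordinate radius. -/
def massFunction (σ h κ : ℝ → ℝ) (r : ℝ) : ℝ :=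
  σ r / 2 * (1 - (deriv σ r / h r) ^ 2 + σ r ^ 2 * κ r ^ 2)

namespace IsProfile

variable {c r₀ : ℝ} {g k : Tensor2 3} {σ h κ lam U V : ℝ → ℝ} {x : Pt 3}

section

variable (hp : IsProfile c r₀ σ h κ U V) (hg : IsWarped c g σ h)
  (hk : IsWarped.IsFrameTensor c σ h k κ lam) (hx : r₀ < ‖x‖)

include hp hg hx

lemma gradNorm_fst : gradNorm g (fun y => U ‖y‖) x = deriv U ‖x‖ / h ‖x‖ :=
  hg.gradNorm_radial (hp.le.trans hx)
    (hasDerivAt_of_contDiffOn_Ioi hp.smooth_fst (hp.le.trans hx)).differentiableAt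
    (hp.pos_fst _ hx).le

lemma gradNorm_snd : gradNorm g (fun y => V ‖y‖) x = deriv V ‖x‖ / h ‖x‖ :=
  hg.gradNorm_radial (hp.le.trans hx)
    (hasDerivAt_of_contDiffOn_Ioi hp.smooth_snd (hp.le.trans hx)).differentiableAt
    (hp.pos_snd _ hx).le

/-- The common quadratic terms of `∇̄²₊ u` and `∇̄²₋ v`. -/
lemma quadratic_terms (i j : Fin 3) :
    (gradNorm g (fun y => U ‖y‖) x * gradNorm g (fun y => V ‖y‖) x
        + gradInner g (fun y => U ‖y‖) (fun y => V ‖y‖) x) / (U ‖x‖ + V ‖x‖) * g x i j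
      - (pd i (fun y => U ‖y‖) x * pd j (fun y => V ‖y‖) x
        + pd j (fun y => U ‖y‖) x * pd i (fun y => V ‖y‖) x) / (U ‖x‖ + V ‖x‖)
      = sphTensor (4 * deriv U ‖x‖ * deriv V ‖x‖ * σ ‖x‖ / (h ‖x‖ * ‖x‖) ^ 2) 0 x i j := by
  have hc := hp.le.trans hx
  have hr := hg.norm_pos hc
  have hσ := hg.radius_pos _ hc
  have hh := hg.speed_pos _ hc
  have dU := hasDerivAt_of_contDiffOn_Ioi hp.smooth_fst hc
  have dV := hasDerivAt_of_contDiffOn_Ioi hp.smooth_snd hc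
  have hx0 := hg.ne_zero hc
  rw [hp.gradNorm_fst hg hx, hp.gradNorm_snd hg hx,
    hg.gradInner_radial hc dU.differentiableAt dV.differentiableAt, hp.add_eq,
    pd_radial hx0 dU, pd_radial hx0 dV, pd_radial hx0 dU, pd_radial hx0 dV,
    hg.eq_sphTensor x hc, sphTensor_apply, sphTensor_apply]
  field_simp
  ring

include hk

/-- The tensor `∇̄²₊ u` has only a radial component. -/
lemma barHessPlus_eq : barHessPlus g k (fun y => U ‖y‖) (fun y => V ‖y‖) x =
    sphTensor 0 (deriv (deriv U) ‖x‖ - deriv U ‖x‖ * deriv h ‖x‖ / h ‖x‖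
      + lam ‖x‖ * h ‖x‖ * deriv U ‖x‖) x := by
  have hc := hp.le.trans hx
  have hr := hg.norm_pos hc
  have hσ := hg.radius_pos _ hc
  have hh := hg.speed_pos _ hc
  ext i j
  have hq := hp.quadratic_terms hg hx i j
  have hH := hg.hess_radial hc hp.smooth_fst
  simp only [barHessPlus, Matrix.of_apply]
  rw [sub_add, hq, hH, hk x hc, hp.gradNorm_fst hg hx, hp.deriv_snd _ hc]
  simp only [sphTensor_apply]
  field_simp
  ring

/-- The tensor `∇̄²₋ v` has only a radial component. -/
lemma barHessMinus_eq : barHessMinus g k (fun y => U ‖y‖) (fun y => V ‖y‖) x =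
    sphTensor 0 (deriv (deriv V) ‖x‖ - deriv V ‖x‖ * deriv h ‖x‖ / h ‖x‖
      - lam ‖x‖ * h ‖x‖ * deriv V ‖x‖) x := by
  have hc := hp.le.trans hx
  have hr := hg.norm_pos hc
  have hσ := hg.radius_pos _ hc
  have hh := hg.speed_pos _ hc
  ext i j
  have hq := hp.quadratic_terms hg hx i j
  have hH := hg.hess_radial hc hp.smooth_snd
  simp only [barHessMinus, Matrix.of_apply]
  rw [sub_add, hq, hH, hk x hc, hp.gradNorm_snd hg hx, hp.deriv_fst _ hc]
  simp only [sphTensor_apply]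
  field_simp
  ring

lemma systemAt : SystemAt 1 g k (fun y => U ‖y‖) (fun y => V ‖y‖) x := by
  have hc := hp.le.trans hx
  have dU := hasDerivAt_of_contDiffOn_Ioi hp.smooth_fst hc
  have dV := hasDerivAt_of_contDiffOn_Ioi hp.smooth_snd hc
  constructor
  · rw [hg.tr_eq hc (hp.barHessPlus_eq hg hk hx), hg.normalPart_radial hc dU.differentiableAt
      (hp.pos_fst _ hx) (hp.barHessPlus_eq hg hk hx)]
    ring
  · rw [hg.tr_eq hc (hp.barHessMinus_eq hg hk hx), hg.normalPart_radial hc dV.differentiableAt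
      (hp.pos_snd _ hx) (hp.barHessMinus_eq hg hk hx)]
    ring

lemma hessianTerm_eq : hessianTerm 1 g k (fun y => U ‖y‖) (fun y => V ‖y‖) x = 0 := by
  have hc := hp.le.trans hx
  have dU := hasDerivAt_of_contDiffOn_Ioi hp.smooth_fst hc
  have dV := hasDerivAt_of_contDiffOn_Ioi hp.smooth_snd hc
  rw [hessianTerm, hg.normSq2_eq hc (hp.barHessPlus_eq hg hk hx),
    hg.normalPart_radial hc dU.differentiableAt (hp.pos_fst _ hx) (hp.barHessPlus_eq hg hk hx),
    hg.normSq2_eq hc (hp.barHessMinus_eq hg hk hx),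
    hg.normalPart_radial hc dV.differentiableAt (hp.pos_snd _ hx) (hp.barHessMinus_eq hg hk hx)]
  ring

omit hk in
lemma gradNorm_add_eq :
    gradNorm g (fun y => U ‖y‖) x + gradNorm g (fun y => V ‖y‖) x = deriv σ ‖x‖ / (2 * h ‖x‖) := by
  have hc := hp.le.trans hx
  have hh := hg.speed_pos _ hc
  rw [hp.gradNorm_fst hg hx, hp.gradNorm_snd hg hx, hp.deriv_fst _ hc, hp.deriv_snd _ hc]
  field_simp
  ring

omit hk in
lemma grad_sub_eq (i : Fin 3) : grad g (fun y => U ‖y‖) x i - grad g (fun y => V ‖y‖) x i =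
    -(κ ‖x‖ * σ ‖x‖ / (2 * ‖x‖ * h ‖x‖)) * x i := by
  have hc := hp.le.trans hx
  have hr := hg.norm_pos hc
  have hh := hg.speed_pos _ hc
  have dU := hasDerivAt_of_contDiffOn_Ioi hp.smooth_fst hc
  have dV := hasDerivAt_of_contDiffOn_Ioi hp.smooth_snd hc
  rw [hg.grad_radial hc dU.differentiableAt, hg.grad_radial hc dV.differentiableAt,
    hp.deriv_fst _ hc, hp.deriv_snd _ hc]
  field_simp
  ring

omit hx hg hk in
lemma deriv_add_eq {r : ℝ} (hr : c < r) : deriv U r + deriv V r = deriv σ r / 2 := by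
  rw [hp.deriv_fst r hr, hp.deriv_snd r hr]
  ring

omit hx hk in
lemma deriv_deriv_add_eq {r : ℝ} (hr : c < r) :
    deriv (deriv U) r + deriv (deriv V) r = deriv (deriv σ) r / 2 := by
  have dU := hasDerivAt_of_contDiffOn_Ioi (contDiffOn_deriv_Ioi hp.smooth_fst) hr
  have dV := hasDerivAt_of_contDiffOn_Ioi (contDiffOn_deriv_Ioi hp.smooth_snd) hr
  have dσ := hasDerivAt_of_contDiffOn_Ioi (contDiffOn_deriv_Ioi hg.smooth_radius) hr
  refine (dU.fun_add dV).unique ((dσ.div_const 2).congr_of_eventuallyEq ?_)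
  exact (eventually_gt_nhds hr).mono fun t ht => hp.deriv_add_eq ht

/-- The field `Y` is radial, and `⟨Y, ν⟩ = -(σ_ρ² - σ² κ²) / σ`. -/
lemma fieldY_eq (i : Fin 3) : fieldY g k (fun y => U ‖y‖) (fun y => V ‖y‖) x i =
    -((deriv σ ‖x‖ / h ‖x‖) ^ 2 / σ ‖x‖ - σ ‖x‖ * κ ‖x‖ ^ 2) / (h ‖x‖ * ‖x‖) * x i := by
  have hc := hp.le.trans hx
  have hr := hg.norm_pos hc
  have hσ := hg.radius_pos _ hc
  have hh := hg.speed_pos _ hc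
  have hU := hp.pos_fst _ hx
  have hV := hp.pos_snd _ hx
  have dU := hasDerivAt_of_contDiffOn_Ioi hp.smooth_fst hc
  have dV := hasDerivAt_of_contDiffOn_Ioi hp.smooth_snd hc
  have dh := hasDerivAt_of_contDiffOn_Ioi hg.smooth_speed hc
  have dσ' := hasDerivAt_of_contDiffOn_Ioi (contDiffOn_deriv_Ioi hg.smooth_radius) hc
  have dG : HasDerivAt (fun r => deriv σ r / (2 * h r)) _ ‖x‖ :=
    dσ'.fun_div (dh.const_mul 2) (mul_pos two_pos hh).ne'
  have hgradsum : grad g (fun y => gradNorm g (fun y => U ‖y‖) y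
      + gradNorm g (fun y => V ‖y‖) y) x i
      = deriv (fun r => deriv σ r / (2 * h r)) ‖x‖ / (‖x‖ * h ‖x‖ ^ 2) * x i := by
    rw [← hg.grad_radial hc dG.differentiableAt, grad, grad]
    refine Finset.sum_congr rfl fun j _ => ?_
    rw [pd_congr ((eventually_lt_norm hx).mono fun y hy => hp.gradNorm_add_eq hg hy)]
  have hksum : ∑ j, ∑ l, ginv g x i j * k x j l *
      (grad g (fun y => U ‖y‖) x l - grad g (fun y => V ‖y‖) x l)
      = -(κ ‖x‖ * σ ‖x‖ / (2 * ‖x‖ * h ‖x‖)) * lam ‖x‖ * x i := by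
    have h1 : ∀ j, ∑ l, ginv g x i j * k x j l *
        (grad g (fun y => U ‖y‖) x l - grad g (fun y => V ‖y‖) x l)
        = -(κ ‖x‖ * σ ‖x‖ / (2 * ‖x‖ * h ‖x‖)) * (lam ‖x‖ * h ‖x‖ ^ 2) *
          (sphTensor ((σ ‖x‖ / ‖x‖) ^ 2)⁻¹ (h ‖x‖ ^ 2)⁻¹ x i j * x j) := fun j => by
      have h2 := sphTensor_sum_mul (κ ‖x‖ * (σ ‖x‖ / ‖x‖) ^ 2) (lam ‖x‖ * h ‖x‖ ^ 2)
        (hg.ne_zero hc) j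
      simp_rw [hp.grad_sub_eq hg hx, hk x hc, hg.ginv_eq hc]
      calc _ = -(κ ‖x‖ * σ ‖x‖ / (2 * ‖x‖ * h ‖x‖))
            * sphTensor ((σ ‖x‖ / ‖x‖) ^ 2)⁻¹ (h ‖x‖ ^ 2)⁻¹ x i j
            * ∑ l, sphTensor (κ ‖x‖ * (σ ‖x‖ / ‖x‖) ^ 2) (lam ‖x‖ * h ‖x‖ ^ 2) x j l * x l := by
            rw [Finset.mul_sum]
            exact Finset.sum_congr rfl fun l _ => by ring
        _ = _ := by rw [h2]; ring
    simp_rw [h1]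
    rw [← Finset.mul_sum, sphTensor_sum_mul _ _ (hg.ne_zero hc)]
    field_simp
  rw [fieldY, hgradsum, dG.deriv, hksum, hp.add_eq, hg.laplacian_radial hc hp.smooth_fst,
    hg.laplacian_radial hc hp.smooth_snd, hg.tr_frame hk hc, hp.grad_sub_eq hg hx,
    hp.gradNorm_fst hg hx, hp.gradNorm_snd hg hx, hg.grad_radial hc dU.differentiableAt,
    hg.grad_radial hc dV.differentiableAt]
  have e2 := hp.deriv_deriv_add_eq hg hc
  have e1 := hp.deriv_fst _ hc
  have e3 := hp.deriv_snd _ hc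
  -- Only the sum of the second derivatives of `U` and `V` enters.
  have hUU : deriv (deriv U) ‖x‖ = deriv (deriv σ) ‖x‖ / 2 - deriv (deriv V) ‖x‖ := by linarith
  rw [hUU]
  field_simp
  rw [e1, e3]
  ring

/-- The flux `⟨Y, ν⟩` of `Y` through the symmetric spheres. -/
lemma flux_eq : ∑ i, ∑ j, g x i j * fieldY g k (fun y => U ‖y‖) (fun y => V ‖y‖) x i *
      unitNormal g (fun y => ‖y‖) x j
      = -((deriv σ ‖x‖ / h ‖x‖) ^ 2 / σ ‖x‖ - σ ‖x‖ * κ ‖x‖ ^ 2) := by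
  have hc := hp.le.trans hx
  have hr := hg.norm_pos hc
  have hσ := hg.radius_pos _ hc
  have hh := hg.speed_pos _ hc
  simp_rw [hp.fieldY_eq hg hk hx, hg.eq_sphTensor x hc,
    hg.unitNormal_radial hc (F := fun r => r) differentiableAt_id (by simp)]
  have h1 := sphTensor_ev_self ((σ ‖x‖ / ‖x‖) ^ 2) (h ‖x‖ ^ 2) (hg.ne_zero hc) 1
  generalize hB : -((deriv σ ‖x‖ / h ‖x‖) ^ 2 / σ ‖x‖ - σ ‖x‖ * κ ‖x‖ ^ 2) = B
  calc _ = B / (h ‖x‖ * ‖x‖) * (‖x‖ * h ‖x‖)⁻¹ *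
        ∑ i, ∑ j, sphTensor ((σ ‖x‖ / ‖x‖) ^ 2) (h ‖x‖ ^ 2) x i j * (1 * x i) * (1 * x j) := by
        simp_rw [Finset.mul_sum]
        exact Finset.sum_congr rfl fun i _ => Finset.sum_congr rfl fun j _ => by ring
    _ = B := by rw [h1]; field_simp

/-- The matter term is the derivative of the Hawking energy. -/
lemma matterTerm_eq (hκ : ContDiffOn ℝ ∞ κ (Set.Ioi c)) (hlam : ContDiffOn ℝ ∞ lam (Set.Ioi c)) :
    matterTerm g k (fun y => U ‖y‖) (fun y => V ‖y‖) x =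
      deriv (massFunction σ h κ) ‖x‖ / (σ ‖x‖ ^ 2 * h ‖x‖) := by
  have hc := hp.le.trans hx
  have hr := hg.norm_pos hc
  have hσ := hg.radius_pos _ hc
  have hh := hg.speed_pos _ hc
  have dh := hasDerivAt_of_contDiffOn_Ioi hg.smooth_speed hc
  have dσ := hasDerivAt_of_contDiffOn_Ioi hg.smooth_radius hc
  have dσ' := hasDerivAt_of_contDiffOn_Ioi (contDiffOn_deriv_Ioi hg.smooth_radius) hc
  have dκ := hasDerivAt_of_contDiffOn_Ioi hκ hc
  have dm : HasDerivAt (massFunction σ h κ) _ ‖x‖ :=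
    (dσ.div_const 2).fun_mul ((((dσ'.fun_div dh hh.ne').fun_pow 2).const_sub 1).fun_add
      ((dσ.fun_pow 2).fun_mul (dκ.fun_pow 2)))
  have hJ : ∑ i, momentumDensity g k x i *
      (grad g (fun y => U ‖y‖) x i - grad g (fun y => V ‖y‖) x i) =
      (-2 * deriv κ ‖x‖ + 2 * deriv σ ‖x‖ * (lam ‖x‖ - κ ‖x‖) / σ ‖x‖) / ‖x‖
        * -(κ ‖x‖ * σ ‖x‖ / (2 * ‖x‖ * h ‖x‖)) * ‖x‖ ^ 2 := by
    rw [← sum_mul_self_coords, Finset.mul_sum]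
    refine Finset.sum_congr rfl fun i _ => ?_
    rw [hg.momentumDensity_eq hk hc hκ hlam, hp.grad_sub_eq hg hx]
    ring
  rw [matterTerm, hJ, hp.gradNorm_add_eq hg hx, hg.energyDensity_eq hk hc, dm.deriv]
  simp only [Nat.cast_ofNat, Nat.add_one_sub_one, pow_one]
  field_simp
  ring

/-- The dominant energy condition makes the matter term nonnegative. -/
lemma matterTerm_nonneg (hκ : ContDiffOn ℝ ∞ κ (Set.Ioi c))
    (hlam : ContDiffOn ℝ ∞ lam (Set.Ioi c)) (hdec : momentumNorm g k x ≤ energyDensity g k x) :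
    0 ≤ matterTerm g k (fun y => U ‖y‖) (fun y => V ‖y‖) x := by
  have hc := hp.le.trans hx
  have hr := hg.norm_pos hc
  have hh := hg.speed_pos _ hc
  rw [hg.momentumNorm_eq hk hc hκ hlam] at hdec
  have dU := hasDerivAt_of_contDiffOn_Ioi hp.smooth_fst hc
  have dV := hasDerivAt_of_contDiffOn_Ioi hp.smooth_snd hc
  set B := -2 * deriv κ ‖x‖ + 2 * deriv σ ‖x‖ * (lam ‖x‖ - κ ‖x‖) / σ ‖x‖ with hB
  have hJ : ∑ i, momentumDensity g k x i *
      (grad g (fun y => U ‖y‖) x i - grad g (fun y => V ‖y‖) x i) =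
      B / h ‖x‖ * ((deriv U ‖x‖ - deriv V ‖x‖) / h ‖x‖) := by
    have : ∑ i, momentumDensity g k x i *
        (grad g (fun y => U ‖y‖) x i - grad g (fun y => V ‖y‖) x i) =
        B / ‖x‖ * ((deriv U ‖x‖ - deriv V ‖x‖) / (‖x‖ * h ‖x‖ ^ 2)) * ∑ i, x i * x i := by
      rw [Finset.mul_sum]
      refine Finset.sum_congr rfl fun i _ => ?_
      rw [hg.momentumDensity_eq hk hc hκ hlam, hg.grad_radial hc dU.differentiableAt,
        hg.grad_radial hc dV.differentiableAt, ← hB]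
      ring
    rw [this, sum_mul_self_coords]
    field_simp
  rw [matterTerm, hJ, hp.gradNorm_fst hg hx, hp.gradNorm_snd hg hx, ← add_div]
  have hU := hp.pos_fst _ hx
  have hV := hp.pos_snd _ hx
  have habs : |deriv U ‖x‖ - deriv V ‖x‖| ≤ deriv U ‖x‖ + deriv V ‖x‖ :=
    abs_le.2 ⟨by linarith, by linarith⟩
  have h1 : |B / h ‖x‖ * ((deriv U ‖x‖ - deriv V ‖x‖) / h ‖x‖)|
      ≤ energyDensity g k x * ((deriv U ‖x‖ + deriv V ‖x‖) / h ‖x‖) := by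
    rw [abs_mul, abs_div, abs_div, abs_of_pos hh]
    exact mul_le_mul hdec (div_le_div_of_nonneg_right habs hh.le) (by positivity)
      (le_trans (by positivity) hdec)
  linarith [neg_abs_le (B / h ‖x‖ * ((deriv U ‖x‖ - deriv V ‖x‖) / h ‖x‖))]

/-- The divergence identity, with the Hessian terms absent and Gaussian curvature `1 / σ²`. -/
lemma diverg_fieldY (hκ : ContDiffOn ℝ ∞ κ (Set.Ioi c)) (hlam : ContDiffOn ℝ ∞ lam (Set.Ioi c)) :
    diverg g (fieldY g k (fun y => U ‖y‖) (fun y => V ‖y‖)) x =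
      2 * matterTerm g k (fun y => U ‖y‖) (fun y => V ‖y‖) x
        - deriv σ ‖x‖ / (σ ‖x‖ ^ 2 * h ‖x‖) := by
  have hc := hp.le.trans hx
  have hr := hg.norm_pos hc
  have hσ := hg.radius_pos _ hc
  have hh := hg.speed_pos _ hc
  have dh := hasDerivAt_of_contDiffOn_Ioi hg.smooth_speed hc
  have dσ := hasDerivAt_of_contDiffOn_Ioi hg.smooth_radius hc
  have dσ' := hasDerivAt_of_contDiffOn_Ioi (contDiffOn_deriv_Ioi hg.smooth_radius) hc
  have dκ := hasDerivAt_of_contDiffOn_Ioi hκ hc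
  have did := hasDerivAt_id' ‖x‖
  have dm : HasDerivAt (massFunction σ h κ) _ ‖x‖ :=
    (dσ.div_const 2).fun_mul ((((dσ'.fun_div dh hh.ne').fun_pow 2).const_sub 1).fun_add
      ((dσ.fun_pow 2).fun_mul (dκ.fun_pow 2)))
  have dξ : HasDerivAt (fun r => -((deriv σ r / h r) ^ 2 / σ r - σ r * κ r ^ 2) / (h r * r))
      _ ‖x‖ :=
    ((((dσ'.fun_div dh hh.ne').fun_pow 2).fun_div dσ hσ.ne').fun_sub
      (dσ.fun_mul (dκ.fun_pow 2))).fun_neg.fun_div (dh.fun_mul did) (mul_pos hh hr).ne'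
  rw [hg.diverg_radial hc ((eventually_lt_norm hx).mono fun y hy i => hp.fieldY_eq hg hk hy i) dξ,
    hp.matterTerm_eq hg hk hx hκ hlam, dm.deriv]
  simp only [Nat.cast_ofNat, Nat.add_one_sub_one, pow_one]
  field_simp
  ring

end

end IsProfile

/-! ### Spherically symmetric initial data as warped products -/

lemma contDiff_axisPt : ContDiff ℝ ∞ axisPt := by
  rw [contDiff_euclidean]
  intro i
  fin_cases i <;> simp [axisPt] <;> fun_prop

lemma contDiffOn_comp_axisPt {c : ℝ} (hc : 0 ≤ c) {f : Pt 3 → ℝ}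
    (hf : ContDiffOn ℝ ∞ f {x | c < ‖x‖}) :
    ContDiffOn ℝ ∞ (fun r => f (axisPt r)) (Set.Ioi c) :=
  hf.comp contDiff_axisPt.contDiffOn fun r hr => by
    rw [Set.mem_ofPred_eq, norm_axisPt (hc.trans (le_of_lt hr))]
    exact hr

namespace SphericalIDS

variable (D : SphericalIDS)

/-- The area radius of the sphere `|x| = r`. -/
def areaRadius (r : ℝ) : ℝ := r * Real.sqrt (D.g (axisPt r) 1 1)

/-- The length of the radial coordinate vector on the sphere `|x| = r`. -/
def speed (r : ℝ) : ℝ := Real.sqrt (D.g (axisPt r) 0 0)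

/-- The value of `k` on unit vectors tangent to the sphere `|x| = r`. -/
def kTang (r : ℝ) : ℝ := D.k (axisPt r) 1 1 / D.g (axisPt r) 1 1

/-- The value of `k` on the unit normal of the sphere `|x| = r`. -/
def kRad (r : ℝ) : ℝ := D.k (axisPt r) 0 0 / D.g (axisPt r) 0 0

/-- The value of `θ₊` on the sphere `|x| = r`. -/
def expansionPlus (r : ℝ) : ℝ :=
  2 * deriv D.areaRadius r / (D.areaRadius r * D.speed r) + 2 * D.kTang r

/-- The value of `θ₋` on the sphere `|x| = r`. -/
def expansionMinus (r : ℝ) : ℝ :=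
  2 * deriv D.areaRadius r / (D.areaRadius r * D.speed r) - 2 * D.kTang r

lemma g_axis_pos {r : ℝ} (hr : D.inner < r) (i : Fin 3) : 0 < D.g (axisPt r) i i :=
  (D.g_posDef _ (by rwa [norm_axisPt (D.inner_nonneg.trans hr.le)])).diag_pos

lemma smooth_g_axis (i j : Fin 3) :
    ContDiffOn ℝ ∞ (fun r => D.g (axisPt r) i j) (Set.Ioi D.inner) :=
  contDiffOn_comp_axisPt D.inner_nonneg (D.g_smooth i j)

lemma smooth_k_axis (i j : Fin 3) :
    ContDiffOn ℝ ∞ (fun r => D.k (axisPt r) i j) (Set.Ioi D.inner) :=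
  contDiffOn_comp_axisPt D.inner_nonneg (D.k_smooth i j)

lemma smooth_kTang : ContDiffOn ℝ ∞ D.kTang (Set.Ioi D.inner) :=
  (D.smooth_k_axis 1 1).div (D.smooth_g_axis 1 1) fun _ hr => (D.g_axis_pos hr 1).ne'

lemma smooth_kRad : ContDiffOn ℝ ∞ D.kRad (Set.Ioi D.inner) :=
  (D.smooth_k_axis 0 0).div (D.smooth_g_axis 0 0) fun _ hr => (D.g_axis_pos hr 0).ne'

lemma areaRadius_div_sq {r : ℝ} (hr : D.inner < r) :
    (D.areaRadius r / r) ^ 2 = D.g (axisPt r) 1 1 := by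
  have hr0 := D.inner_nonneg.trans_lt hr
  rw [areaRadius, mul_div_cancel_left₀ _ hr0.ne', Real.sq_sqrt (D.g_axis_pos hr 1).le]

lemma speed_sq {r : ℝ} (hr : D.inner < r) : D.speed r ^ 2 = D.g (axisPt r) 0 0 :=
  Real.sq_sqrt (D.g_axis_pos hr 0).le

lemma isWarped : IsWarped D.inner D.g D.areaRadius D.speed where
  nonneg := D.inner_nonneg
  smooth_radius := contDiffOn_id.mul
    ((D.smooth_g_axis 1 1).sqrt fun _ hr => (D.g_axis_pos hr 1).ne')
  smooth_speed := (D.smooth_g_axis 0 0).sqrt fun _ hr => (D.g_axis_pos hr 0).ne'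
  radius_pos := fun _ hr =>
    mul_pos (D.inner_nonneg.trans_lt hr) (Real.sqrt_pos.2 (D.g_axis_pos hr 1))
  speed_pos := fun _ hr => Real.sqrt_pos.2 (D.g_axis_pos hr 0)
  eq_sphTensor := fun x hx => by
    rw [D.areaRadius_div_sq hx, D.speed_sq hx]
    exact eq_sphTensor_of_invariant D.inner_nonneg
      (fun y hy => Matrix.isHermitian_iff_isSymm.1 (D.g_posDef y hy).isHermitian) D.g_inv hx

lemma isFrameTensor :
    IsWarped.IsFrameTensor D.inner D.areaRadius D.speed D.k D.kTang D.kRad := fun x hx => by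
  rw [D.areaRadius_div_sq hx, D.speed_sq hx, kTang, kRad,
    div_mul_cancel₀ _ (D.g_axis_pos hx 1).ne', div_mul_cancel₀ _ (D.g_axis_pos hx 0).ne']
  exact eq_sphTensor_of_invariant D.inner_nonneg D.k_symm D.k_inv hx

section values

variable {x : Pt 3} {r : ℝ}

lemma trSphere_eq (hx : D.inner < ‖x‖) : D.trSphere x = 2 * D.kTang ‖x‖ :=
  D.isWarped.tangTrace_frame D.isFrameTensor hx

lemma thetaPlus_eq (hx : D.inner < ‖x‖) : D.thetaPlus x = D.expansionPlus ‖x‖ := by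
  rw [thetaPlus, expansionPlus, D.trSphere_eq hx, D.isWarped.meanCurv_norm hx]

lemma thetaMinus_eq (hx : D.inner < ‖x‖) : D.thetaMinus x = D.expansionMinus ‖x‖ := by
  rw [thetaMinus, expansionMinus, D.trSphere_eq hx, D.isWarped.meanCurv_norm hx]

lemma sqrt_area_eq (hr : D.inner < r) :
    Real.sqrt (D.area r / (16 * Real.pi)) = D.areaRadius r / 2 := by
  have hσ := D.isWarped.radius_pos _ hr
  rw [area, D.isWarped.sphereIntegral_of_const hr (K := 1) fun _ _ => rfl,
    show 4 * Real.pi * D.areaRadius r ^ 2 * 1 / (16 * Real.pi) = (D.areaRadius r / 2) ^ 2 by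
      field_simp; ring, Real.sqrt_sq (by positivity)]

lemma expansionIntegral_eq (hr : D.inner < r) : D.expansionIntegral r =
    4 * Real.pi * D.areaRadius r ^ 2 * (D.expansionPlus r * D.expansionMinus r) :=
  D.isWarped.sphereIntegral_of_const hr fun x hx => by
    rw [D.thetaPlus_eq (hx ▸ hr), D.thetaMinus_eq (hx ▸ hr), hx]

lemma expansion_mul_eq (hr : D.inner < r) : D.expansionPlus r * D.expansionMinus r =
    4 * ((deriv D.areaRadius r / D.speed r) ^ 2 / D.areaRadius r ^ 2 - D.kTang r ^ 2) := by
  have hσ := D.isWarped.radius_pos _ hr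
  have hh := D.isWarped.speed_pos _ hr
  rw [expansionPlus, expansionMinus]
  field_simp
  ring

lemma hawkingMass_eq (hr : D.inner < r) :
    D.hawkingMass r = massFunction D.areaRadius D.speed D.kTang r := by
  have hσ := D.isWarped.radius_pos _ hr
  have hh := D.isWarped.speed_pos _ hr
  rw [hawkingMass, D.sqrt_area_eq hr, D.expansionIntegral_eq hr, D.expansion_mul_eq hr,
    massFunction]
  field_simp
  ring

lemma isMOTS_iff (hr : D.inner < r) : D.IsMOTS r ↔ D.expansionPlus r = 0 := by
  have hn := norm_axisPt (D.inner_nonneg.trans hr.le)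
  constructor
  · intro h
    have := h (axisPt r) hn
    rwa [D.thetaPlus_eq (by rwa [hn]), hn] at this
  · intro h x hx
    rw [D.thetaPlus_eq (hx ▸ hr), hx, h]

lemma isMITS_iff (hr : D.inner < r) : D.IsMITS r ↔ D.expansionMinus r = 0 := by
  have hn := norm_axisPt (D.inner_nonneg.trans hr.le)
  constructor
  · intro h
    have := h (axisPt r) hn
    rwa [D.thetaMinus_eq (by rwa [hn]), hn] at this
  · intro h x hx
    rw [D.thetaMinus_eq (hx ▸ hr), hx, h]

lemma isUntrapped_iff (hr : D.inner < r) :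
    D.IsUntrapped r ↔ 0 < D.expansionPlus r ∧ 0 < D.expansionMinus r := by
  have hn := norm_axisPt (D.inner_nonneg.trans hr.le)
  constructor
  · intro h
    have := h (axisPt r) hn
    rwa [D.thetaPlus_eq (by rwa [hn]), D.thetaMinus_eq (by rwa [hn]), hn] at this
  · intro h x hx
    rw [D.thetaPlus_eq (hx ▸ hr), D.thetaMinus_eq (hx ▸ hr), hx]
    exact h

end values

lemma continuousOn_meanCurv : ContinuousOn
    (fun r => 2 * deriv D.areaRadius r / (D.areaRadius r * D.speed r)) (Set.Ioi D.inner) :=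
  (((contDiffOn_deriv_Ioi D.isWarped.smooth_radius).continuousOn.const_mul 2)).div
    (D.isWarped.smooth_radius.continuousOn.mul D.isWarped.smooth_speed.continuousOn)
    fun r hr => (mul_pos (D.isWarped.radius_pos r hr) (D.isWarped.speed_pos r hr)).ne'

lemma continuousOn_expansionPlus : ContinuousOn D.expansionPlus (Set.Ioi D.inner) :=
  D.continuousOn_meanCurv.add (D.smooth_kTang.continuousOn.const_mul 2)

lemma continuousOn_expansionMinus : ContinuousOn D.expansionMinus (Set.Ioi D.inner) :=
  D.continuousOn_meanCurv.sub (D.smooth_kTang.continuousOn.const_mul 2)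

end SphericalIDS

/-- A continuous function without zeros on a half-line which is positive somewhere is positive. -/
lemma pos_of_ne_zero_of_pos {r₀ : ℝ} {f : ℝ → ℝ} (hf : ContinuousOn f (Set.Ioi r₀))
    (h0 : ∀ r, r₀ < r → f r ≠ 0) {r₁ : ℝ} (h1 : r₀ < r₁) (hpos : 0 < f r₁) {r : ℝ} (hr : r₀ < r) :
    0 < f r := by
  by_contra hneg
  obtain ⟨t, ht, hft⟩ := (isPreconnected_Ioi (a := r₀)).intermediate_value hr h1 hf
    ⟨not_lt.1 hneg, hpos.le⟩
  exact h0 t ht hft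

namespace SphericalIDS

variable (D : SphericalIDS) {r₀ : ℝ}

/-- Outside an outermost horizon all symmetric spheres are untrapped once one of them is. -/
lemma expansion_pos (hhor : D.IsOutermostHorizon r₀) (hend : ∃ r, r₀ < r ∧ D.IsUntrapped r)
    {r : ℝ} (hr : r₀ < r) : 0 < D.expansionPlus r ∧ 0 < D.expansionMinus r := by
  obtain ⟨r₁, h1, hu⟩ := hend
  obtain ⟨hin, -, hout⟩ := hhor
  have hsub : Set.Ioi r₀ ⊆ Set.Ioi D.inner := Set.Ioi_subset_Ioi hin.le
  have hpos := (D.isUntrapped_iff (hin.trans h1)).1 hu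
  constructor
  · exact pos_of_ne_zero_of_pos (D.continuousOn_expansionPlus.mono hsub)
      (fun t ht h => (hout t ht).1 ((D.isMOTS_iff (hin.trans ht)).2 h)) h1 hpos.1 hr
  · exact pos_of_ne_zero_of_pos (D.continuousOn_expansionMinus.mono hsub)
      (fun t ht h => (hout t ht).2 ((D.isMITS_iff (hin.trans ht)).2 h)) h1 hpos.2 hr

lemma hawkingMass_horizon (hhor : D.IsOutermostHorizon r₀) :
    D.hawkingMass r₀ = D.areaRadius r₀ / 2 := by
  obtain ⟨hin, h, -⟩ := hhor
  have h0 : D.expansionPlus r₀ * D.expansionMinus r₀ = 0 := by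
    rw [D.isMOTS_iff hin, D.isMITS_iff hin] at h
    exact mul_eq_zero.2 h
  rw [hawkingMass, D.sqrt_area_eq hin, D.expansionIntegral_eq hin, h0]
  ring

/-- The radial profile of `w = v - u`, the arclength integral of `(tr_Σ k) s / 2`. -/
def profileDiff (r₀ r : ℝ) : ℝ :=
  ∫ τ in r₀..r, D.kTang τ * D.areaRadius τ * D.speed τ / 2

lemma hasDerivAt_profileDiff (hin : D.inner < r₀) {r : ℝ} (hr : D.inner < r) :
    HasDerivAt (D.profileDiff r₀) (D.kTang r * D.areaRadius r * D.speed r / 2) r := by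
  have hc : ContinuousOn (fun τ => D.kTang τ * D.areaRadius τ * D.speed τ / 2) (Set.Ioi D.inner) :=
    ((D.smooth_kTang.continuousOn.mul D.isWarped.smooth_radius.continuousOn).mul
      D.isWarped.smooth_speed.continuousOn).div_const 2
  have hsub : Set.uIcc r₀ r ⊆ Set.Ioi D.inner := fun t ht =>
    (lt_min hin hr).trans_le ht.1
  exact intervalIntegral.integral_hasDerivAt_right (hc.mono hsub).intervalIntegrable
    (hc.stronglyMeasurableAtFilter isOpen_Ioi r hr) (hc.continuousAt (Ioi_mem_nhds hr))

lemma smooth_profileDiff (hin : D.inner < r₀) :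
    ContDiffOn ℝ ∞ (D.profileDiff r₀) (Set.Ioi D.inner) := by
  refine (contDiffOn_infty_iff_deriv_of_isOpen isOpen_Ioi).2
    ⟨fun r hr => (D.hasDerivAt_profileDiff hin hr).differentiableAt.differentiableWithinAt, ?_⟩
  exact (((D.smooth_kTang.mul D.isWarped.smooth_radius).mul D.isWarped.smooth_speed).div_const
    2).congr fun r hr => (D.hasDerivAt_profileDiff hin hr).deriv

/-- The radial profile of `u`. -/
def profileFst (r₀ r : ℝ) : ℝ := (D.areaRadius r / 2 - D.profileDiff r₀ r) / 2

/-- The radial profile of `v`. -/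
def profileSnd (r₀ r : ℝ) : ℝ := (D.areaRadius r / 2 + D.profileDiff r₀ r) / 2

lemma isProfile (hhor : D.IsOutermostHorizon r₀) (hend : ∃ r, r₀ < r ∧ D.IsUntrapped r) :
    IsProfile D.inner r₀ D.areaRadius D.speed D.kTang (D.profileFst r₀) (D.profileSnd r₀) := by
  have hin := hhor.1
  have hU : ∀ r, D.inner < r → deriv (D.profileFst r₀) r =
      (deriv D.areaRadius r - D.kTang r * D.areaRadius r * D.speed r) / 4 := fun r hr => by
    have h1 := (((hasDerivAt_of_contDiffOn_Ioi D.isWarped.smooth_radius hr).div_const 2).fun_sub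
      (D.hasDerivAt_profileDiff hin hr)).div_const 2
    rw [show D.profileFst r₀ = _ from rfl]
    refine h1.deriv.trans ?_
    ring
  have hV : ∀ r, D.inner < r → deriv (D.profileSnd r₀) r =
      (deriv D.areaRadius r + D.kTang r * D.areaRadius r * D.speed r) / 4 := fun r hr => by
    have h1 := (((hasDerivAt_of_contDiffOn_Ioi D.isWarped.smooth_radius hr).div_const 2).fun_add
      (D.hasDerivAt_profileDiff hin hr)).div_const 2
    refine h1.deriv.trans ?_
    ring
  refine ⟨hin, ?_, ?_, ?_, hU, hV, ?_, ?_⟩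
  · exact ((D.isWarped.smooth_radius.div_const 2).sub (D.smooth_profileDiff hin)).div_const 2
  · exact ((D.isWarped.smooth_radius.div_const 2).add (D.smooth_profileDiff hin)).div_const 2
  · intro r
    rw [profileFst, profileSnd]
    ring
  · intro r hr
    have hσ := D.isWarped.radius_pos _ (hin.trans hr)
    have hh := D.isWarped.speed_pos _ (hin.trans hr)
    have hm := (D.expansion_pos hhor hend hr).2
    have : (deriv D.areaRadius r - D.kTang r * D.areaRadius r * D.speed r) / 4 =
        D.expansionMinus r * (D.areaRadius r * D.speed r) / 8 := by
      rw [expansionMinus]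
      field_simp
      ring
    rw [hU r (hin.trans hr), this]
    positivity
  · intro r hr
    have hσ := D.isWarped.radius_pos _ (hin.trans hr)
    have hh := D.isWarped.speed_pos _ (hin.trans hr)
    have hm := (D.expansion_pos hhor hend hr).1
    have : (deriv D.areaRadius r + D.kTang r * D.areaRadius r * D.speed r) / 4 =
        D.expansionPlus r * (D.areaRadius r * D.speed r) / 8 := by
      rw [expansionPlus]
      field_simp
      ring
    rw [hV r (hin.trans hr), this]
    positivity

lemma profile_pos (hhor : D.IsOutermostHorizon r₀) (hend : ∃ r, r₀ < r ∧ D.IsUntrapped r)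
    {r : ℝ} (hr : r₀ ≤ r) : 0 < D.profileFst r₀ r ∧ 0 < D.profileSnd r₀ r := by
  have hp := D.isProfile hhor hend
  have hin := hhor.1
  have hσ := D.isWarped.radius_pos _ hin
  have hsub : Set.Ici r₀ ⊆ Set.Ioi D.inner := fun t ht => lt_of_lt_of_le hin ht
  have h0 : D.profileDiff r₀ r₀ = 0 := by simp [profileDiff]
  have hU : MonotoneOn (D.profileFst r₀) (Set.Ici r₀) := by
    refine monotoneOn_of_deriv_nonneg (convex_Ici r₀) (hp.smooth_fst.continuousOn.mono hsub) ?_ ?_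
    · rw [interior_Ici]
      exact fun t ht => (hasDerivAt_of_contDiffOn_Ioi hp.smooth_fst
        (hin.trans ht)).differentiableAt.differentiableWithinAt
    · rw [interior_Ici]
      exact fun t ht => (hp.pos_fst t ht).le
  have hV : MonotoneOn (D.profileSnd r₀) (Set.Ici r₀) := by
    refine monotoneOn_of_deriv_nonneg (convex_Ici r₀) (hp.smooth_snd.continuousOn.mono hsub) ?_ ?_
    · rw [interior_Ici]
      exact fun t ht => (hasDerivAt_of_contDiffOn_Ioi hp.smooth_snd
        (hin.trans ht)).differentiableAt.differentiableWithinAt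
    · rw [interior_Ici]
      exact fun t ht => (hp.pos_snd t ht).le
  have h1 := hU Set.self_mem_Ici hr hr
  have h2 := hV Set.self_mem_Ici hr hr
  have e1 : D.profileFst r₀ r₀ = D.areaRadius r₀ / 4 := by rw [profileFst, h0]; ring
  have e2 : D.profileSnd r₀ r₀ = D.areaRadius r₀ / 4 := by rw [profileSnd, h0]; ring
  constructor <;> linarith

lemma radialSpeed_eq {n : Pt 3} (hn : ‖n‖ = 1) {τ : ℝ} (hτ : D.inner < τ) :
    D.radialSpeed n τ = D.speed τ := by
  have hτ0 := D.inner_nonneg.trans_lt hτ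
  have hnorm : ‖τ • n‖ = τ := by rw [norm_smul, hn, mul_one, Real.norm_of_nonneg hτ0.le]
  have hh := D.isWarped.speed_pos _ hτ
  have h1 := sphTensor_ev_self ((D.areaRadius τ / τ) ^ 2) (D.speed τ ^ 2)
    (x := τ • n) (by rw [← norm_pos_iff, hnorm]; exact hτ0) τ⁻¹
  have hni : ∀ i, τ⁻¹ * (τ • n) i = n i := fun i => by
    simp only [PiLp.smul_apply, smul_eq_mul]
    field_simp
  simp_rw [hni] at h1
  rw [radialSpeed, ev, D.isWarped.eq_sphTensor _ (by rwa [hnorm]), hnorm, h1, hnorm,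
    show D.speed τ ^ 2 * τ⁻¹ ^ 2 * τ ^ 2 = D.speed τ ^ 2 by field_simp, Real.sqrt_sq hh.le]

lemma radialIntegral_eq (hin : D.inner < r₀) {x : Pt 3} (hx : r₀ ≤ ‖x‖) :
    D.radialIntegral r₀ (fun y => 1 / 2 * D.trSphere y * (D.areaRadius ‖y‖ / 2)) x
      = D.profileDiff r₀ ‖x‖ := by
  have hx0 : 0 < ‖x‖ := D.inner_nonneg.trans_lt (hin.trans_le hx)
  have hn : ‖‖x‖⁻¹ • x‖ = 1 := by
    rw [norm_smul, norm_inv, norm_norm, inv_mul_cancel₀ hx0.ne']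
  refine intervalIntegral.integral_congr fun τ hτ => ?_
  rw [Set.uIcc_of_le hx] at hτ
  have hτi : D.inner < τ := hin.trans_le hτ.1
  have hnorm : ‖τ • (‖x‖⁻¹ • x)‖ = τ := by
    rw [norm_smul, hn, mul_one, Real.norm_of_nonneg (D.inner_nonneg.trans hτi.le)]
  dsimp only
  rw [D.trSphere_eq (by rwa [hnorm]), hnorm, D.radialSpeed_eq hn hτi]
  ring

end SphericalIDS

/-! ### Asymptotically flat ends -/

lemma tendsto_zero_of_decay {q C : ℝ} (hq : 0 < q) {f : ℝ → ℝ}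
    (hf : ∀ᶠ r in atTop, |f r| ≤ C * r ^ (-q)) : Tendsto f atTop (𝓝 0) := by
  refine squeeze_zero_norm' hf ?_
  simpa using (tendsto_rpow_neg_atTop hq).const_mul C

/-- Decay faster than `r^{-1/2}` makes `r f²` negligible. -/
lemma tendsto_mul_sq_zero_of_decay {q C : ℝ} (hq : 1 / 2 < q) {f : ℝ → ℝ}
    (hf : ∀ᶠ r in atTop, |f r| ≤ C * r ^ (-q)) :
    Tendsto (fun r => r * f r ^ 2) atTop (𝓝 0) := by
  have hq' : 0 < 2 * q - 1 := by linarith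
  refine tendsto_zero_of_decay (C := C ^ 2) hq' ?_
  filter_upwards [hf, eventually_gt_atTop 0] with r hr h0
  have h1 : f r ^ 2 ≤ (C * r ^ (-q)) ^ 2 := by
    rw [← sq_abs]
    exact pow_le_pow_left₀ (abs_nonneg _) hr 2
  have h2 : r ^ (-(2 * q - 1)) = r * (r ^ (-q)) ^ 2 := by
    rw [← Real.rpow_natCast (r ^ (-q)), ← Real.rpow_mul h0.le]
    conv_rhs => rw [← Real.rpow_one r, Real.rpow_one r]
    rw [show -(2 * q - 1) = 1 + -q * ((2 : ℕ) : ℝ) by push_cast; ring, Real.rpow_add h0,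
      Real.rpow_one]
  rw [abs_of_nonneg (by positivity), h2]
  calc r * f r ^ 2 ≤ r * (C * r ^ (-q)) ^ 2 := by gcongr
    _ = C ^ 2 * (r * (r ^ (-q)) ^ 2) := by ring

lemma hasDerivAt_axisPt (r : ℝ) : HasDerivAt axisPt (EuclideanSpace.single 0 1) r := by
  have h1 : axisPt = fun t => t • EuclideanSpace.single 0 (1 : ℝ) := by
    ext t i
    fin_cases i <;> simp [axisPt]
  rw [h1]
  simpa using (hasDerivAt_id' r).smul_const (EuclideanSpace.single (0 : Fin 3) (1 : ℝ))

namespace SphericalIDS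

variable (D : SphericalIDS)

lemma deriv_g_axis {r : ℝ} (hr : D.inner < r) (i j : Fin 3) :
    deriv (fun t => D.g (axisPt t) i j) r = pd 0 (fun y => D.g y i j) (axisPt r) := by
  have hd : DifferentiableAt ℝ (fun y => D.g y i j) (axisPt r) :=
    ((D.g_smooth i j).contDiffAt ((isOpen_lt continuous_const continuous_norm).mem_nhds (by
      rw [Set.mem_ofPred_eq, norm_axisPt (D.inner_nonneg.trans hr.le)]
      exact hr))).differentiableAt (by simp)
  exact (hd.hasFDerivAt.comp_hasDerivAt r (hasDerivAt_axisPt r)).deriv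

/-- The decay of the radial coefficients of an asymptotically flat data set. -/
lemma decay (hAF : D.IsAsymptoticallyFlat) : ∃ q C : ℝ, 1 / 2 < q ∧
    (∀ᶠ r in atTop, |D.g (axisPt r) 1 1 - 1| ≤ C * r ^ (-q)) ∧
    (∀ᶠ r in atTop, |D.g (axisPt r) 0 0 - 1| ≤ C * r ^ (-q)) ∧
    (∀ᶠ r in atTop, |r * deriv (fun t => D.g (axisPt t) 1 1) r| ≤ C * r ^ (-q)) ∧
    (∀ᶠ r in atTop, |r * D.k (axisPt r) 1 1| ≤ C * r ^ (-q)) := by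
  obtain ⟨q, C, R, hq, hdec⟩ := hAF
  have hmul : ∀ r : ℝ, 0 < r → ∀ t : ℝ, |t| ≤ C * r ^ (-q - 1) → |r * t| ≤ C * r ^ (-q) := by
    intro r hr t ht
    rw [abs_mul, abs_of_pos hr]
    calc r * |t| ≤ r * (C * r ^ (-q - 1)) := by gcongr
      _ = C * r ^ (-q) := by
        rw [Real.rpow_sub_one hr.ne']
        field_simp
  refine ⟨q, C, hq, ?_, ?_, ?_, ?_⟩ <;>
    filter_upwards [eventually_gt_atTop D.inner, eventually_ge_atTop R] with r h1 h2
  all_goals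
    have hn := norm_axisPt (D.inner_nonneg.trans h1.le)
    have h0 := D.inner_nonneg.trans_lt h1
    have key := hdec (axisPt r) (by rwa [hn]) (by rwa [hn])
    rw [hn] at key
  · simpa using (key 1 1 0 0).1
  · simpa using (key 0 0 0 0).1
  · rw [D.deriv_g_axis h1]
    exact hmul r h0 _ (key 1 1 0 0).2.1
  · exact hmul r h0 _ (key 1 1 0 0).2.2.2.1

lemma deriv_areaRadius {r : ℝ} (hr : D.inner < r) : deriv D.areaRadius r =
    Real.sqrt (D.g (axisPt r) 1 1)
      + r * deriv (fun t => D.g (axisPt t) 1 1) r / (2 * Real.sqrt (D.g (axisPt r) 1 1)) := by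
  have h1 := (hasDerivAt_of_contDiffOn_Ioi (D.smooth_g_axis 1 1) hr).sqrt (D.g_axis_pos hr 1).ne'
  have h2 : HasDerivAt D.areaRadius _ r := (hasDerivAt_id' r).fun_mul h1
  rw [h2.deriv]
  ring

lemma exists_untrapped (hAF : D.IsAsymptoticallyFlat) (r₀ : ℝ) :
    ∃ r, r₀ < r ∧ D.IsUntrapped r := by
  obtain ⟨q, C, hq, ha, hb, hda, hk⟩ := D.decay hAF
  have hq0 : 0 < q := by linarith
  have ta : Tendsto (fun r => D.g (axisPt r) 1 1) atTop (𝓝 1) := by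
    simpa using (tendsto_zero_of_decay hq0 ha).add_const 1
  have tb : Tendsto (fun r => D.g (axisPt r) 0 0) atTop (𝓝 1) := by
    simpa using (tendsto_zero_of_decay hq0 hb).add_const 1
  have tsa : Tendsto (fun r => √(D.g (axisPt r) 1 1)) atTop (𝓝 1) := by simpa using ta.sqrt
  have tsb : Tendsto (fun r => √(D.g (axisPt r) 0 0)) atTop (𝓝 1) := by simpa using tb.sqrt
  have t1 : Tendsto (fun r => √(D.g (axisPt r) 1 1)
      + r * deriv (fun t => D.g (axisPt t) 1 1) r / (2 * √(D.g (axisPt r) 1 1))) atTop (𝓝 1) := by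
    simpa using tsa.add ((tendsto_zero_of_decay hq0 hda).div (tsa.const_mul 2) (by norm_num))
  have t2 : Tendsto (fun r => r * D.k (axisPt r) 1 1 / D.g (axisPt r) 1 1 *
      (√(D.g (axisPt r) 1 1) * √(D.g (axisPt r) 0 0))) atTop (𝓝 0) := by
    simpa using ((tendsto_zero_of_decay hq0 hk).div ta one_ne_zero).mul (tsa.mul tsb)
  have hplus := (t1.add t2).eventually (lt_mem_nhds (show (0 : ℝ) < 1 + 0 by norm_num))
  have hminus := (t1.sub t2).eventually (lt_mem_nhds (show (0 : ℝ) < 1 - 0 by norm_num))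
  obtain ⟨r, h1, h2, h3, h4⟩ := (hplus.and (hminus.and
    ((eventually_gt_atTop D.inner).and (eventually_gt_atTop r₀)))).exists
  refine ⟨r, h4, (D.isUntrapped_iff h3).2 ?_⟩
  have hσ := D.isWarped.radius_pos _ h3
  have hh := D.isWarped.speed_pos _ h3
  have hkσ : r * D.k (axisPt r) 1 1 / D.g (axisPt r) 1 1 *
      (√(D.g (axisPt r) 1 1) * √(D.g (axisPt r) 0 0))
      = D.kTang r * (D.areaRadius r * D.speed r) := by
    rw [kTang, areaRadius, speed]
    ring
  rw [hkσ, ← D.deriv_areaRadius h3] at h1 h2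
  constructor
  · have : D.expansionPlus r = 2 * (deriv D.areaRadius r
        + D.kTang r * (D.areaRadius r * D.speed r)) / (D.areaRadius r * D.speed r) := by
      rw [expansionPlus]
      field_simp
    rw [this]
    positivity
  · have : D.expansionMinus r = 2 * (deriv D.areaRadius r
        - D.kTang r * (D.areaRadius r * D.speed r)) / (D.areaRadius r * D.speed r) := by
      rw [expansionMinus]
      field_simp
    rw [this]
    positivity

/-- The flux integral which defines the ADM energy. -/
lemma adm_energy_flux {r : ℝ} (hr : D.inner < r) :
    1 / (16 * Real.pi) * sphereIntegral flat r (fun x =>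
      ∑ i, ∑ j, (pd i (fun y => D.g y i j) x - pd j (fun y => D.g y i i) x) * (x j / ‖x‖))
    = (r * (D.g (axisPt r) 0 0 - D.g (axisPt r) 1 1)
        - r * (r * deriv (fun t => D.g (axisPt t) 1 1) r)) / 2 := by
  have hr0 := D.inner_nonneg.trans_lt hr
  rw [isWarped_flat.sphereIntegral_of_const hr0
    (K := 2 * (D.g (axisPt r) 0 0 - D.g (axisPt r) 1 1) / r
      - 2 * deriv (fun t => D.g (axisPt t) 1 1) r)]
  · field_simp
    ring
  intro x hx
  have hxc : D.inner < ‖x‖ := hx ▸ hr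
  have hx0 := D.isWarped.ne_zero hxc
  have da := hasDerivAt_of_contDiffOn_Ioi (D.smooth_g_axis 1 1) hxc
  have db := hasDerivAt_of_contDiffOn_Ioi (D.smooth_g_axis 0 0) hxc
  have dβ : HasDerivAt
      (fun t => (D.g (axisPt t) 0 0 - D.g (axisPt t) 1 1) / t ^ 2) _ ‖x‖ :=
    (db.fun_sub da).fun_div ((hasDerivAt_id' ‖x‖).fun_pow 2)
      (pow_pos (D.isWarped.norm_pos hxc) 2).ne'
  have hpd : ∀ l i j, pd l (fun y => D.g y i j) x = _ := fun l i j =>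
    (pd_congr ((eventually_lt_norm hxc).mono fun y hy => by
      dsimp only
      rw [D.isWarped.eq_sphTensor y hy, D.areaRadius_div_sq hy, D.speed_sq hy,
        sphTensor_apply]) l).trans (pd_tensor hx0 da dβ l i j)
  simp only [hpd]
  generalize ((deriv (fun r => D.g (axisPt r) 0 0) ‖x‖ - deriv (fun r => D.g (axisPt r) 1 1) ‖x‖)
    * ‖x‖ ^ 2 - (D.g (axisPt ‖x‖) 0 0 - D.g (axisPt ‖x‖) 1 1)
      * (((2 : ℕ) : ℝ) * ‖x‖ ^ (2 - 1) * 1)) / (‖x‖ ^ 2) ^ 2 = B1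
  have hn := norm_sq_coords x
  rw [hx] at hn ⊢
  generalize deriv (fun t => D.g (axisPt t) 1 1) r = A1
  generalize D.g (axisPt r) 1 1 = A0
  generalize D.g (axisPt r) 0 0 = B0
  have hsum : ∀ X Y Z : ℝ, ∑ i : Fin 3, ∑ j : Fin 3,
      ((X * x i * (if i = j then 1 else 0)
          + (Y * ((if True then 1 else 0) * x j + (if i = j then 1 else 0) * x i)
            + Z * (x i * x i * x j)))
        - (X * x j * (if True then 1 else 0)
          + (Y * ((if j = i then 1 else 0) * x i + (if j = i then 1 else 0) * x i)
            + Z * (x j * x i * x i)))) * (x j / r)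
      = 2 * (Y - X) * (x 0 ^ 2 + x 1 ^ 2 + x 2 ^ 2) / r := fun X Y Z => by
    simp [Fin.sum_univ_three]
    ring
  refine (hsum _ _ _).trans ?_
  rw [← hn]
  field_simp

/-- The Hawking energy tends to the ADM energy along the symmetric spheres. -/
lemma tendsto_hawkingMass (hAF : D.IsAsymptoticallyFlat) {E : ℝ} (hE : D.HasADMEnergy E) :
    Tendsto D.hawkingMass atTop (𝓝 E) := by
  obtain ⟨q, C, hq, ha, hb, hda, hk⟩ := D.decay hAF
  have hq0 : 0 < q := by linarith
  have ta : Tendsto (fun r => D.g (axisPt r) 1 1) atTop (𝓝 1) := by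
    simpa using (tendsto_zero_of_decay hq0 ha).add_const 1
  have tb : Tendsto (fun r => D.g (axisPt r) 0 0) atTop (𝓝 1) := by
    simpa using (tendsto_zero_of_decay hq0 hb).add_const 1
  have tsa : Tendsto (fun r => √(D.g (axisPt r) 1 1)) atTop (𝓝 1) := by simpa using ta.sqrt
  have tda := tendsto_mul_sq_zero_of_decay hq hda
  have tk := tendsto_mul_sq_zero_of_decay hq hk
  have tE : Tendsto (fun r => (r * (D.g (axisPt r) 0 0 - D.g (axisPt r) 1 1)
      - r * (r * deriv (fun t => D.g (axisPt t) 1 1) r)) / 2) atTop (𝓝 E) :=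
    Tendsto.congr' ((eventually_gt_atTop D.inner).mono fun r hr => D.adm_energy_flux hr) hE
  -- With `a`, `b` the tangential and radial coefficients of `g` and `p` the tangential one of `k`,
  -- `m = (√a / b) (r (b - a) - r² a') / 2 - √a / (8 a b) r (r a')² + √a / (2 a) r (r p)²`.
  have tmain := (((tsa.div tb one_ne_zero).mul tE).sub
    ((tsa.div ((ta.mul tb).const_mul 8) (by norm_num)).mul tda)).add
    ((tsa.div (ta.const_mul 2) (by norm_num)).mul tk)
  have hlim : (1 : ℝ) / 1 * E - 1 / (8 * (1 * 1)) * 0 + 1 / (2 * 1) * 0 = E := by ring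
  rw [hlim] at tmain
  refine tmain.congr' ((eventually_gt_atTop D.inner).mono fun r hr => ?_)
  have hr0 := D.inner_nonneg.trans_lt hr
  have hpa := D.g_axis_pos hr 1
  have hpb := D.g_axis_pos hr 0
  have h1 := Real.sq_sqrt hpa.le
  have h2 := Real.sq_sqrt hpb.le
  have h3 := Real.sqrt_pos.2 hpa
  have h4 := Real.sqrt_pos.2 hpb
  rw [D.hawkingMass_eq hr, massFunction, D.deriv_areaRadius hr, areaRadius, speed, kTang]
  dsimp only [Pi.div_apply]
  generalize deriv (fun t => D.g (axisPt t) 1 1) r = A1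
  generalize √(D.g (axisPt r) 1 1) = sa at *
  generalize √(D.g (axisPt r) 0 0) = sb at *
  rw [← h1, ← h2]
  field_simp
  ring

lemma adm_momentum_eq_zero {P : Pt 3} (hP : D.HasADMMomentum P) : P = 0 := by
  ext i
  refine tendsto_nhds_unique (hP i) (tendsto_const_nhds.congr' ?_)
  filter_upwards [eventually_gt_atTop D.inner] with r hr
  have hr0 := D.inner_nonneg.trans_lt hr
  rw [sphereIntegral_flat_linear hr0 (i := i)
    (K := (D.kRad r * D.speed r ^ 2 - (2 * D.kTang r + D.kRad r) * D.speed r ^ 2) / r)]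
  · simp
  intro x hx
  have hxc : D.inner < ‖x‖ := hx ▸ hr
  have hx0 := D.isWarped.ne_zero hxc
  have h1 := sphTensor_sum_mul (D.kTang ‖x‖ * (D.areaRadius ‖x‖ / ‖x‖) ^ 2)
    (D.kRad ‖x‖ * D.speed ‖x‖ ^ 2) hx0 i
  have h2 := sphTensor_sum_mul ((D.areaRadius ‖x‖ / ‖x‖) ^ 2) (D.speed ‖x‖ ^ 2) hx0 i
  rw [← D.isFrameTensor x hxc] at h1
  rw [← D.isWarped.eq_sphTensor x hxc] at h2
  rw [D.isWarped.tr_frame D.isFrameTensor hxc]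
  calc _ = ((∑ j, D.k x i j * x j)
        - (2 * D.kTang ‖x‖ + D.kRad ‖x‖) * ∑ j, D.g x i j * x j) / ‖x‖ := by
        rw [Finset.mul_sum, ← Finset.sum_sub_distrib, Finset.sum_div]
        exact Finset.sum_congr rfl fun j _ => by ring
    _ = _ := by rw [h1, h2, hx]; ring

end SphericalIDS

/-! ### Monotonicity and the Penrose inequality -/

namespace IsWarped

variable {c r₀ : ℝ} {g k : Tensor2 3} {σ h κ lam : ℝ → ℝ} {x : Pt 3}

/-- Half the area radius moves by the rescaled inverse mean curvature flow. -/
lemma rescaledIMCFAt (hg : IsWarped c g σ h) (hx : c < ‖x‖) (hσ' : 0 < deriv σ ‖x‖) :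
    gradNorm g (fun y => σ ‖y‖ / 2) x ≠ 0 ∧ RescaledIMCFAt g (fun y => σ ‖y‖ / 2) x := by
  have hσ := hg.radius_pos _ hx
  have hh := hg.speed_pos _ hx
  have hF : ContDiffOn ℝ ∞ (fun r => σ r / 2) (Set.Ioi c) := hg.smooth_radius.div_const 2
  have dF := (hasDerivAt_of_contDiffOn_Ioi hF hx).differentiableAt
  have hd : deriv (fun r => σ r / 2) ‖x‖ = deriv σ ‖x‖ / 2 := deriv_div_const 2
  have hpos : 0 < deriv (fun r => σ r / 2) ‖x‖ := by rw [hd]; positivity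
  have hN : gradNorm g (fun y => σ ‖y‖ / 2) x = deriv σ ‖x‖ / 2 / h ‖x‖ := by
    rw [hg.gradNorm_radial hx (F := fun r => σ r / 2) dF hpos.le, hd]
  refine ⟨by rw [hN]; positivity, ?_⟩
  rw [RescaledIMCFAt, hN, hg.laplacian_radial hx hF,
    hg.normalPart_radial hx (F := fun r => σ r / 2) dF hpos (hg.hess_radial hx hF), hd]
  field_simp
  ring

lemma smooth_massFunction (hg : IsWarped c g σ h) (hκ : ContDiffOn ℝ ∞ κ (Set.Ioi c)) :
    ContDiffOn ℝ ∞ (massFunction σ h κ) (Set.Ioi c) :=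
  (hg.smooth_radius.div_const 2).mul ((contDiffOn_const.sub
    (((contDiffOn_deriv_Ioi hg.smooth_radius).div hg.smooth_speed
      fun r hr => (hg.speed_pos r hr).ne').pow 2)).add ((hg.smooth_radius.pow 2).mul (hκ.pow 2)))

end IsWarped

/-- The integrals over shells of the matter term, of the curvature term, and of `div Y`. -/
lemma IsProfile.shellIntegrals {c r₀ : ℝ} {g k : Tensor2 3} {σ h κ lam U V : ℝ → ℝ}
    (hp : IsProfile c r₀ σ h κ U V) (hg : IsWarped c g σ h)
    (hk : IsWarped.IsFrameTensor c σ h k κ lam) (hκ : ContDiffOn ℝ ∞ κ (Set.Ioi c))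
    (hlam : ContDiffOn ℝ ∞ lam (Set.Ioi c)) {r₁ r₂ : ℝ} (h1 : r₀ ≤ r₁) (h12 : r₁ ≤ r₂) :
    (IntegrableOn (fun x => matterTerm g k (fun y => U ‖y‖) (fun y => V ‖y‖) x * volDensity g x)
        (shell r₁ r₂) ∧
      shellIntegral g r₁ r₂ (matterTerm g k (fun y => U ‖y‖) (fun y => V ‖y‖)) =
        4 * Real.pi * (massFunction σ h κ r₂ - massFunction σ h κ r₁)) ∧
    (IntegrableOn (fun x => (1 / σ ‖x‖ ^ 2 * gradNorm g (fun y => U ‖y‖) x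
        + 1 / σ ‖x‖ ^ 2 * gradNorm g (fun y => V ‖y‖) x) * volDensity g x) (shell r₁ r₂) ∧
      shellIntegral g r₁ r₂ (fun x => 1 / σ ‖x‖ ^ 2 * gradNorm g (fun y => U ‖y‖) x
        + 1 / σ ‖x‖ ^ 2 * gradNorm g (fun y => V ‖y‖) x) =
        4 * Real.pi * (σ r₂ / 2 - σ r₁ / 2)) ∧
    (IntegrableOn (fun x => diverg g (fieldY g k (fun y => U ‖y‖) (fun y => V ‖y‖)) x
        * volDensity g x) (shell r₁ r₂) ∧
      shellIntegral g r₁ r₂ (diverg g (fieldY g k (fun y => U ‖y‖) (fun y => V ‖y‖))) =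
        4 * Real.pi * ((2 * massFunction σ h κ r₂ - σ r₂)
          - (2 * massFunction σ h κ r₁ - σ r₁))) := by
  have hc1 := hp.le.trans_le h1
  have hm := hg.smooth_massFunction hκ
  refine ⟨hg.shellIntegral_of_deriv hm hc1 h12 fun x hx =>
      hp.matterTerm_eq hg hk (h1.trans_lt hx.1) hκ hlam,
    hg.shellIntegral_of_deriv (hg.smooth_radius.div_const 2) hc1 h12 fun x hx => ?_,
    hg.shellIntegral_of_deriv (Ψ := fun r => 2 * massFunction σ h κ r - σ r)
      ((contDiffOn_const.mul hm).sub hg.smooth_radius) hc1 h12 fun x hx => ?_⟩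
  · have hxc := hc1.trans hx.1
    have hh := hg.speed_pos _ hxc
    have hd : deriv (fun r => σ r / 2) ‖x‖ = deriv σ ‖x‖ / 2 := deriv_div_const 2
    rw [← mul_add, hp.gradNorm_add_eq hg (h1.trans_lt hx.1), hd]
    field_simp
  · have hxc := hc1.trans hx.1
    have hd : deriv (fun r => 2 * massFunction σ h κ r - σ r) ‖x‖
        = 2 * deriv (massFunction σ h κ) ‖x‖ - deriv σ ‖x‖ :=
      (((hasDerivAt_of_contDiffOn_Ioi hm hxc).const_mul 2).fun_sub
        (hasDerivAt_of_contDiffOn_Ioi hg.smooth_radius hxc)).deriv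
    rw [hp.diverg_fieldY hg hk (h1.trans_lt hx.1) hκ hlam,
      hp.matterTerm_eq hg hk (h1.trans_lt hx.1) hκ hlam, hd]
    ring

namespace SphericalIDS

variable (D : SphericalIDS) {r₀ : ℝ}

/-- The spacetime Hawking energy is nondecreasing outside the horizon. -/
lemma hawkingMass_mono (hhor : D.IsOutermostHorizon r₀) (hdec : D.DECOutside r₀)
    (hend : ∃ r, r₀ < r ∧ D.IsUntrapped r) {r₁ r₂ : ℝ} (h1 : r₀ ≤ r₁) (h12 : r₁ ≤ r₂) :
    D.hawkingMass r₁ ≤ D.hawkingMass r₂ := by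
  have hp := D.isProfile hhor hend
  have hint := (hp.shellIntegrals D.isWarped D.isFrameTensor D.smooth_kTang D.smooth_kRad
    h1 h12).1.2
  have hnonneg : 0 ≤ shellIntegral D.g r₁ r₂
      (matterTerm D.g D.k (fun y => D.profileFst r₀ ‖y‖) (fun y => D.profileSnd r₀ ‖y‖)) :=
    setIntegral_nonneg (measurableSet_shell r₁ r₂) fun x hx => mul_nonneg
      (hp.matterTerm_nonneg D.isWarped D.isFrameTensor (h1.trans_lt hx.1) D.smooth_kTang
        D.smooth_kRad (hdec x (h1.trans hx.1.le))) (Real.sqrt_nonneg _)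
  rw [hint] at hnonneg
  rw [D.hawkingMass_eq (hp.le.trans_le h1), D.hawkingMass_eq (hp.le.trans_le (h1.trans h12))]
  have := (mul_nonneg_iff_of_pos_left (by positivity)).1 hnonneg
  linarith

lemma smooth_comp_norm {F : ℝ → ℝ} (hF : ContDiffOn ℝ ∞ F (Set.Ioi D.inner))
    (hin : D.inner < r₀) : ContDiffOn ℝ ∞ (fun x : Pt 3 => F ‖x‖) {x | r₀ ≤ ‖x‖} :=
  hF.comp (fun _ hx => (contDiffAt_norm ℝ (norm_pos_iff.1
    ((D.inner_nonneg.trans_lt hin).trans_le hx))).contDiffWithinAt) fun _ hx => hin.trans_le hx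

end SphericalIDS

end SphIDS



end

theorem theorem4p2 (D : SphIDS.SphericalIDS) (r₀ : ℝ)
    (hhor : D.IsOutermostHorizon r₀) (hdec : D.DECOutside r₀)
    (hend : D.IsAsymptoticallyFlat ∨ ∃ r, r₀ < r ∧ D.IsUntrapped r) :
    -- solvability of the system with `a = 1`
    (∃ s w u v Ku Kv : SphIDS.Pt 3 → ℝ,
      (∀ x, u x + v x = s x ∧ v x - u x = w x) ∧
      ContDiffOn ℝ ∞ u {x | r₀ ≤ ‖x‖} ∧ ContDiffOn ℝ ∞ v {x | r₀ ≤ ‖x‖} ∧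
      (∀ x, r₀ ≤ ‖x‖ → 0 < u x ∧ 0 < v x) ∧
      (∀ x y, r₀ ≤ ‖x‖ → ‖x‖ = ‖y‖ → u x = u y ∧ v x = v y) ∧
      -- `s` solves rescaled IMCF, starting from the horizon
      (∀ x, ‖x‖ = r₀ → s x = Real.sqrt (D.area r₀ / (16 * Real.pi))) ∧
      (∀ x, r₀ < ‖x‖ → SphIDS.gradNorm D.g s x ≠ 0 ∧ SphIDS.RescaledIMCFAt D.g s x) ∧
      (∀ x, r₀ ≤ ‖x‖ → s x = Real.sqrt (D.area ‖x‖ / (16 * Real.pi))) ∧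
      -- `w` is explicit
      (∀ x, r₀ ≤ ‖x‖ →
        w x = D.radialIntegral r₀ (fun y => (1 / 2) * D.trSphere y * s y) x) ∧
      -- `(u, v)` solves the system with `a = 1`, with nonvanishing gradients
      (∀ x, r₀ < ‖x‖ →
        SphIDS.gradNorm D.g u x ≠ 0 ∧ SphIDS.gradNorm D.g v x ≠ 0 ∧
        SphIDS.SystemAt 1 D.g D.k u v x ∧
        SphIDS.gradNorm D.g v x = (1 / 4) * D.thetaPlus x * s x ∧
        SphIDS.gradNorm D.g u x = (1 / 4) * D.thetaMinus x * s x) ∧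
      -- the divergence identity with `a = 1`, and the values of its terms
      (∀ x, r₀ < ‖x‖ →
        SphIDS.HasGaussCurvAt D.g u x (Ku x) ∧ SphIDS.HasGaussCurvAt D.g v x (Kv x) ∧
        SphIDS.diverg D.g (SphIDS.fieldY D.g D.k u v) x =
          SphIDS.hessianTerm 1 D.g D.k u v x + 2 * SphIDS.matterTerm D.g D.k u v x
            - 2 * Ku x * SphIDS.gradNorm D.g u x - 2 * Kv x * SphIDS.gradNorm D.g v x ∧
        SphIDS.hessianTerm 1 D.g D.k u v x = 0 ∧
        0 ≤ SphIDS.matterTerm D.g D.k u v x ∧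
        (∑ i, ∑ j, D.g x i j * SphIDS.fieldY D.g D.k u v x i *
            SphIDS.unitNormal D.g (fun y => ‖y‖) x j) =
          -(1 / 2) * s x * (D.thetaPlus x * D.thetaMinus x)) ∧
      -- the integrated identity is the monotonicity formula of the Hawking energy
      (∀ r₁ r₂, r₀ ≤ r₁ → r₁ ≤ r₂ →
        IntegrableOn (fun x => SphIDS.diverg D.g (SphIDS.fieldY D.g D.k u v) x *
          SphIDS.volDensity D.g x) (SphIDS.shell r₁ r₂) ∧
        IntegrableOn (fun x => (Ku x * SphIDS.gradNorm D.g u x +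
          Kv x * SphIDS.gradNorm D.g v x) * SphIDS.volDensity D.g x) (SphIDS.shell r₁ r₂) ∧
        IntegrableOn (fun x => SphIDS.matterTerm D.g D.k u v x *
          SphIDS.volDensity D.g x) (SphIDS.shell r₁ r₂) ∧
        SphIDS.shellIntegral D.g r₁ r₂ (SphIDS.diverg D.g (SphIDS.fieldY D.g D.k u v)) =
          -(1 / 2) * Real.sqrt (D.area r₂ / (16 * Real.pi)) * D.expansionIntegral r₂
          + (1 / 2) * Real.sqrt (D.area r₁ / (16 * Real.pi)) * D.expansionIntegral r₁ ∧
        SphIDS.shellIntegral D.g r₁ r₂ (fun x => Ku x * SphIDS.gradNorm D.g u x +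
            Kv x * SphIDS.gradNorm D.g v x) =
          4 * Real.pi * (Real.sqrt (D.area r₂ / (16 * Real.pi))
            - Real.sqrt (D.area r₁ / (16 * Real.pi))) ∧
        D.hawkingMass r₂ - D.hawkingMass r₁ =
          1 / (4 * Real.pi) *
            SphIDS.shellIntegral D.g r₁ r₂ (SphIDS.matterTerm D.g D.k u v))) ∧
    -- monotonicity of the spacetime Hawking energy
    (∀ r₁ r₂, r₀ ≤ r₁ → r₁ ≤ r₂ → D.hawkingMass r₁ ≤ D.hawkingMass r₂) ∧
    -- the Penrose inequality
    (D.IsAsymptoticallyFlat → ∀ (E : ℝ) (P : SphIDS.Pt 3),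
      D.HasADMEnergy E → D.HasADMMomentum P →
        ‖P‖ ≤ E ∧
        Real.sqrt (D.area r₀ / (16 * Real.pi)) ≤ Real.sqrt (E ^ 2 - ‖P‖ ^ 2)) := by
  have hend' : ∃ r, r₀ < r ∧ D.IsUntrapped r := hend.elim (fun h => D.exists_untrapped h r₀) id
  have hin := hhor.1
  have hg := D.isWarped
  have hk := D.isFrameTensor
  have hκ := D.smooth_kTang
  have hlam := D.smooth_kRad
  have hp := D.isProfile hhor hend'
  have hmono : ∀ r₁ r₂, r₀ ≤ r₁ → r₁ ≤ r₂ → D.hawkingMass r₁ ≤ D.hawkingMass r₂ :=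
    fun r₁ r₂ h1 h12 => D.hawkingMass_mono hhor hdec hend' h1 h12
  refine ⟨⟨fun x => D.areaRadius ‖x‖ / 2, fun x => D.profileDiff r₀ ‖x‖,
    fun x => D.profileFst r₀ ‖x‖, fun x => D.profileSnd r₀ ‖x‖,
    fun x => 1 / D.areaRadius ‖x‖ ^ 2, fun x => 1 / D.areaRadius ‖x‖ ^ 2, ?_, ?_, ?_, ?_, ?_, ?_,
    ?_, ?_, ?_, ?_, ?_, ?_⟩, hmono, ?_⟩
  · intro x
    simp only [SphIDS.SphericalIDS.profileFst, SphIDS.SphericalIDS.profileSnd]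
    constructor <;> ring
  · exact D.smooth_comp_norm hp.smooth_fst hin
  · exact D.smooth_comp_norm hp.smooth_snd hin
  · exact fun x hx => D.profile_pos hhor hend' hx
  · intro x y _ hxy
    simp only [hxy, and_self]
  · intro x hx
    rw [D.sqrt_area_eq hin, ← hx]
  · intro x hx
    refine hg.rescaledIMCFAt (hin.trans hx) ?_
    have h1 := hp.deriv_add_eq (hin.trans hx)
    linarith [hp.pos_fst _ hx, hp.pos_snd _ hx]
  · intro x hx
    rw [D.sqrt_area_eq (hin.trans_le hx)]
  · intro x hx
    exact (D.radialIntegral_eq hin hx).symm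
  · intro x hx
    have hxc := hin.trans hx
    have hσ := hg.radius_pos _ hxc
    have hh := hg.speed_pos _ hxc
    have h1 := hp.gradNorm_fst hg hx
    have h2 := hp.gradNorm_snd hg hx
    refine ⟨?_, ?_, hp.systemAt hg hk hx, ?_, ?_⟩
    · rw [h1]
      exact (div_pos (hp.pos_fst _ hx) hh).ne'
    · rw [h2]
      exact (div_pos (hp.pos_snd _ hx) hh).ne'
    · rw [h2, hp.deriv_snd _ hxc, D.thetaPlus_eq hxc, SphIDS.SphericalIDS.expansionPlus]
      field_simp
    · rw [h1, hp.deriv_fst _ hxc, D.thetaMinus_eq hxc, SphIDS.SphericalIDS.expansionMinus]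
      field_simp
  · intro x hx
    have hxc := hin.trans hx
    have hσ := hg.radius_pos _ hxc
    have hh := hg.speed_pos _ hxc
    refine ⟨hg.hasGaussCurvAt hxc _, hg.hasGaussCurvAt hxc _, ?_, hp.hessianTerm_eq hg hk hx,
      hp.matterTerm_nonneg hg hk hx hκ hlam (hdec x hx.le), ?_⟩
    · have h1 := hp.gradNorm_add_eq hg hx
      rw [hp.diverg_fieldY hg hk hx hκ hlam, hp.hessianTerm_eq hg hk hx, sub_sub, mul_assoc 2,
        mul_assoc 2, ← mul_add, ← mul_add, h1]
      field_simp
      ring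
    · rw [hp.flux_eq hg hk hx, D.thetaPlus_eq hxc, D.thetaMinus_eq hxc, D.expansion_mul_eq hxc]
      field_simp
      ring
  · intro r₁ r₂ h1 h12
    have hc1 := hin.trans_le h1
    have hc2 := hc1.trans_le h12
    obtain ⟨⟨i1, e1⟩, ⟨i2, e2⟩, ⟨i3, e3⟩⟩ := hp.shellIntegrals hg hk hκ hlam h1 h12
    refine ⟨i3, i2, i1, ?_, ?_, ?_⟩
    · rw [e3, ← D.hawkingMass_eq hc1, ← D.hawkingMass_eq hc2, SphIDS.SphericalIDS.hawkingMass,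
        SphIDS.SphericalIDS.hawkingMass, D.sqrt_area_eq hc1, D.sqrt_area_eq hc2]
      field_simp
      ring
    · rw [e2, D.sqrt_area_eq hc1, D.sqrt_area_eq hc2]
    · rw [e1, D.hawkingMass_eq hc1, D.hawkingMass_eq hc2]
      field_simp
  · intro hAF E P hE hP
    have hP0 := D.adm_momentum_eq_zero hP
    have hle : D.areaRadius r₀ / 2 ≤ E := by
      rw [← D.hawkingMass_horizon hhor]
      exact ge_of_tendsto (D.tendsto_hawkingMass hAF hE)
        ((eventually_ge_atTop r₀).mono fun r hr => hmono r₀ r le_rfl hr)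
    have hE0 : 0 ≤ E := le_trans (by have := hg.radius_pos _ hin; positivity) hle
    rw [hP0, norm_zero, D.sqrt_area_eq hin]
    exact ⟨hE0, by simpa [Real.sqrt_sq hE0] using hle⟩
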